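/- Let $A\subset[0,\infty)$ be closed and $Q\subset[0,\infty)$ compact, with $0\in A\cap Q$, $A\setminus\{0\}\ne\emptyset$, $Q\setminus\{0\}\ne\emptyset$, and let $\beta>0$. Let $R:Q\to[0,\infty)$ be continuous with $R(0)=0$, and let $C:A\to[0,\infty)$ be continuous and non-decreasing; if $A$ is unbounded, assume also that $C(\alpha)/\alpha\to+\infty$ as $A\ni\alpha\to+\infty$. No concavity of $R$ or convexity of $C$ is assumed. For $x\ge0$ let $\mathscr A(x)$ be the set of pairs of Borel functions $\alpha:[0,\infty)\to A$, $q:[0,\infty)\to Q$, with $\alpha$ locally integrable, such that $X_t=x+\int_0^t(\alpha_s-q_s)\,ds\ge0$ for all $t\ge0$, and let $$v(x)=\sup_{(\alpha,q)\in\mathscr A(x)}\int_0^\infty e^{-\beta t}\bigl(R(q_t)-C(\alpha_t)\bigr)\,dt,\qquad x\ge 0,$$ where the integral is $-\infty$ if $\int_0^\infty e^{-\beta t}C(\alpha_t)\,dt=\infty$. For $z\in\mathbb R$ put $$H(z)=\widehat R(z)+\widehat C(z),\qquad \widehat R(z)=\sup_{q\in Q}\{R(q)-qz\},\qquad \widehat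 C(z)=\sup_{\alpha\in A}\{\alpha z-C(\alpha)\}.$$ Then $H$ is finite and has a least minimum point $\zeta$ over $\mathbb R$, and $\zeta\ge0$. The function $v$ is finite and bounded, and $$v(x)\le\frac{H(0)}{\beta}=\lim_{y\to\infty}v(y),\qquad x\ge 0.$$ (i) If $\zeta=0$, then $v(x)=H(0)/\beta$ for all $x\ge0$. (ii) If $\zeta>0$, then $H$ is differentiable a.e. on $(0,\zeta)$, the formula $$\Psi(\xi)=-\int_\xi^\zeta\frac{H'(z)}{\beta z}\,dz$$ defines (with a convergent integral) a bijection $\Psi:(0,\zeta]\to[0,\infty)$, and, with its inverse $\xi:[0,\infty)\to(0,\zeta]$, $$v(x)=\frac{H(\xi(x))}{\beta}=\frac{H(\zeta)}{\beta}+\int_0^x\xi(y)\,dy,\qquad x\ge0.$$ In this case $v$ is continuously differentiable on $[0,\infty)$ (one-sided derivative at $0$), strictly increasing and strictly concave; $v'$ is absolutely continuous on $[0,\infty)$, that is, for every $\varepsilon>0$ there is $\delta>0$ such that $\sum_i|v'(b_i)-v'(a_i)|<\varepsilon$ for every finite family of disjoint intervals $(a_i,b_i)$ with $[a_i,b_i]\subset[0,\infty)$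 and $\sum_i(b_i-a_i)<\delta$; $v'(0)=\zeta$; $\lim_{x\to\infty}v'(x)=0$; and for almost every $x>0$ the second derivative $v''(x)$ exists and is negative. -/

import Mathlib

open Set Filter Topology MeasureTheory

noncomputable section

namespace Firm

/-- `R̂(z) = sup_{q ∈ Q} (R(q) - q z)`. -/
def Rhat (Q : Set ℝ) (R : ℝ → ℝ) (z : ℝ) : ℝ :=
  sSup ((fun q => R q - q * z) '' Q)

/-- `Ĉ(z) = sup_{a ∈ A} (a z - C(a))`. -/
def Chat (A : Set ℝ) (C : ℝ → ℝ) (z : ℝ) : ℝ :=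
  sSup ((fun a => a * z - C a) '' A)

/-- The Hamiltonian `H = R̂ + Ĉ`. -/
def hamiltonian (A Q : Set ℝ) (R C : ℝ → ℝ) (z : ℝ) : ℝ :=
  Rhat Q R z + Chat A C z

/-- The set of minimum points of the Hamiltonian over the real line. -/
def minPoints (A Q : Set ℝ) (R C : ℝ → ℝ) : Set ℝ :=
  {z | ∀ w : ℝ, hamiltonian A Q R C z ≤ hamiltonian A Q R C w}

/-- The least minimum point `ζ` of the Hamiltonian. -/
def zeta (A Q : Set ℝ) (R C : ℝ → ℝ) : ℝ :=
  sInf (minPoints A Q R C)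

/-- The inventory level `X_t = x + ∫₀ᵗ (α_s - q_s) ds`. -/
def inventory (x : ℝ) (α q : ℝ → ℝ) (t : ℝ) : ℝ :=
  x + ∫ s in (0 : ℝ)..t, (α s - q s)

/-- Admissible strategies for the initial inventory `x`: Borel functions on `[0, ∞)` with values
in `A` and `Q` that keep the inventory non-negative.  Only the values at times `t ≥ 0` matter;
`α` is locally integrable, so that the inventory is a real number (`q` is bounded when `Q` is
compact). -/
structure Admissible (A Q : Set ℝ) (x : ℝ) (α q : ℝ → ℝ) : Prop where
  measurable_prod : Measurable α
  measurable_sales : Measurable q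
  prod_mem : ∀ t, 0 ≤ t → α t ∈ A
  sales_mem : ∀ t, 0 ≤ t → q t ∈ Q
  intervalIntegrable_prod : ∀ t, 0 ≤ t → IntervalIntegrable α volume 0 t
  inventory_nonneg : ∀ t, 0 ≤ t → 0 ≤ inventory x α q t

/-- The discounted profit `∫₀^∞ e^{-β t} (R(q_t) - C(α_t)) dt`, as an extended real number.
For non-negative `R` and `C` with `R` bounded the first integral is finite, so the profit is
well defined; it is `-∞` exactly when the discounted cost is infinite. -/
def profit (R C : ℝ → ℝ) (β : ℝ) (α q : ℝ → ℝ) : EReal :=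
  ((∫⁻ t in Ioi (0 : ℝ), ENNReal.ofReal (Real.exp (-β * t) * R (q t)) : ENNReal) : EReal) -
    ((∫⁻ t in Ioi (0 : ℝ), ENNReal.ofReal (Real.exp (-β * t) * C (α t)) : ENNReal) : EReal)

/-- The supremum of the discounted profit over admissible strategies, in `[-∞, ∞]`. -/
def extValue (A Q : Set ℝ) (R C : ℝ → ℝ) (β x : ℝ) : EReal :=
  ⨆ (α : ℝ → ℝ) (q : ℝ → ℝ) (_ : Admissible A Q x α q), profit R C β α q

/-- The value function `v(x)`, as a real number. -/
def value (A Q : Set ℝ) (R C : ℝ → ℝ) (β x : ℝ) : ℝ :=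
  (extValue A Q R C β x).toReal

/-- The derivative `v'` on `[0, ∞)`, one-sided at `0`. -/
def valueDeriv (A Q : Set ℝ) (R C : ℝ → ℝ) (β x : ℝ) : ℝ :=
  derivWithin (value A Q R C β) (Ici 0) x

/-- The integrand `H'(z) / (β z)`. -/
def psiIntegrand (A Q : Set ℝ) (R C : ℝ → ℝ) (β z : ℝ) : ℝ :=
  deriv (hamiltonian A Q R C) z / (β * z)

/-- `Ψ(ξ) = -∫_ξ^ζ H'(z) / (β z) dz`. -/
def Psi (A Q : Set ℝ) (R C : ℝ → ℝ) (β ξ : ℝ) : ℝ :=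
  -∫ z in ξ..(zeta A Q R C), psiIntegrand A Q R C β z

/-- The inverse `ξ` of `Ψ : (0, ζ] → [0, ∞)`. -/
def xi (A Q : Set ℝ) (R C : ℝ → ℝ) (β : ℝ) : ℝ → ℝ :=
  Function.invFunOn (Psi A Q R C β) (Ioc 0 (zeta A Q R C))

/-- Absolute continuity of `ψ` on an interval `I`, which may be unbounded. -/
def AbsContOn (ψ : ℝ → ℝ) (I : Set ℝ) : Prop :=
  ∀ ε : ℝ, 0 < ε → ∃ δ : ℝ, 0 < δ ∧ ∀ (k : ℕ) (a b : Fin k → ℝ),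
    (∀ i, a i < b i ∧ Icc (a i) (b i) ⊆ I) →
    (∀ i j, i ≠ j → Disjoint (Ioo (a i) (b i)) (Ioo (a j) (b j))) →
    ∑ i, (b i - a i) < δ → ∑ i, |ψ (b i) - ψ (a i)| < ε

end Firm

end

/-!
The problem is solved by convex duality along an explicit costate.

For a costate `p`, every admissible pair has profit rate `R(q) - C(α) ≤ H(p) - p X'`, with equality
when `α` and `q` are maximisers at `p`.  The running profit does not depend on the inventory, so an
optimal costate grows like `p₀ exp (β t)`: its discounted value is the constant `p₀`.  It does so
until it reaches `ζ`, where it stops.  Along this costate the discounted value is non-increasing, so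
after integration by parts the constraint `X ≥ 0` gives the dual bound
`v(x) ≤ H(p₀) / β + p₀ (x - Ψ(p₀))` for every `p₀ ∈ (0, ζ]` (`Firm.Model.profit_le`).

Conversely take `p₀ = ξ(x)`.  The maximisers along the costate have net production `H'(p)` (for
almost every `p`), and the substitution `p = p₀ exp (β t)` shows that the inventory equals `Ψ(p)`:
it is non-negative and vanishes exactly when `p` reaches `ζ`.  From then on it is held near `0` by
chattering between maximisers at costates just below and just above the minimum point `ζ`
(`Firm.Model.exists_holding`).  This attains the dual bound up to `ε`
(`Firm.Model.exists_strategy`), whence `v(x) = H(ξ(x)) / β`.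

The dual bound at `p₀ = ξ(x)` is affine in the inventory and touches `v` at `x`, so `ξ(x)` is a
supergradient of `v` at `x`.  As `ξ` is continuous, `v' = ξ`, and the regularity of `v` is that of
`ξ`.  The latter follows from two-sided slope bounds for `Ψ`: it is expanding away from `ζ`, which
makes `ξ` Lipschitz away from `0` and, being monotone and continuous, absolutely continuous up to
`0`; and it is Lipschitz away from `0`, which keeps the slope of `ξ` away from zero, so that
`v'' < 0` wherever it exists.  All this only uses that a monotone selection of subgradients of the
convex function `H`, here `Firm.drift`, is its derivative off a countable set.
-/

/-! ### The Hamiltonian and its maximisers -/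

namespace Firm

/-- The standing assumptions on the data of the control problem. -/
structure Model (A Q : Set ℝ) (R C : ℝ → ℝ) (β : ℝ) : Prop where
  beta_pos : 0 < β
  prod_closed : IsClosed A
  prod_nonneg : A ⊆ Ici 0
  sales_compact : IsCompact Q
  sales_nonneg : Q ⊆ Ici 0
  zero_mem_prod : (0 : ℝ) ∈ A
  zero_mem_sales : (0 : ℝ) ∈ Q
  prod_nontrivial : (A \ {0}).Nonempty
  sales_nontrivial : (Q \ {0}).Nonempty
  revenue_cont : ContinuousOn R Q
  revenue_nonneg : ∀ q ∈ Q, 0 ≤ R q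
  revenue_zero : R 0 = 0
  cost_cont : ContinuousOn C A
  cost_nonneg : ∀ a ∈ A, 0 ≤ C a
  cost_mono : MonotoneOn C A
  cost_coercive : ¬ Bornology.IsBounded A → Tendsto (fun a => C a / a) (atTop ⊓ 𝓟 A) atTop

/-- A maximiser of `a ↦ a z - C a` over `A` (a junk value if there is none). -/
noncomputable def optProd (A : Set ℝ) (C : ℝ → ℝ) (z : ℝ) : ℝ :=
  Classical.epsilon fun a => a ∈ A ∧ ∀ b ∈ A, b * z - C b ≤ a * z - C a

/-- A maximiser of `q ↦ R q - q z` over `Q` (a junk value if there is none). -/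
noncomputable def optSales (Q : Set ℝ) (R : ℝ → ℝ) (z : ℝ) : ℝ :=
  Classical.epsilon fun q => q ∈ Q ∧ ∀ b ∈ Q, R b - b * z ≤ R q - q * z

/-- The net production rate of the chosen maximisers at the costate `z`; it is a selection of the
subdifferential of the Hamiltonian. -/
noncomputable def drift (A Q : Set ℝ) (R C : ℝ → ℝ) (z : ℝ) : ℝ :=
  optProd A C z - optSales Q R z

/-- A function with a continuous selection `g` of subgradients is differentiable, with
derivative `g`. -/
theorem hasDerivWithinAt_of_subgradient {f g : ℝ → ℝ} {S : Set ℝ} {x : ℝ} (hx : x ∈ S)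
    (hfg : ∀ z ∈ S, ∀ w ∈ S, f z + g z * (w - z) ≤ f w) (hg : ContinuousWithinAt g S x) :
    HasDerivWithinAt f (g x) S x := by
  rw [hasDerivWithinAt_iff_isLittleO, Asymptotics.isLittleO_iff]
  intro c hc
  have h1 : ∀ᶠ w in 𝓝[S] x, |g w - g x| < c := by
    have := hg.tendsto.eventually (Metric.ball_mem_nhds (g x) hc)
    filter_upwards [this] with w hw
    simpa [Real.dist_eq] using hw
  filter_upwards [h1, self_mem_nhdsWithin] with w hw hwS
  have h2 := hfg x hx w hwS
  have h3 := hfg w hwS x hx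
  have h4 : 0 ≤ f w - f x - (w - x) * g x := by linarith
  have h5 : f w - f x - (w - x) * g x ≤ (g w - g x) * (w - x) := by linarith
  rw [smul_eq_mul, Real.norm_eq_abs, Real.norm_eq_abs, abs_of_nonneg h4]
  calc _ ≤ (g w - g x) * (w - x) := h5
    _ ≤ |(g w - g x) * (w - x)| := le_abs_self _
    _ = |g w - g x| * |w - x| := abs_mul _ _
    _ ≤ c * |w - x| := by gcongr

namespace Model

variable {A Q : Set ℝ} {R C : ℝ → ℝ} {β : ℝ}

theorem exists_optProd (M : Model A Q R C β) (z : ℝ) :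
    ∃ a ∈ A, ∀ b ∈ A, b * z - C b ≤ a * z - C a := by
  have hcont : ContinuousOn (fun a => a * z - C a) A :=
    (continuous_id.mul continuous_const).continuousOn.sub M.cost_cont
  by_cases hb : Bornology.IsBounded A
  · obtain ⟨a, ha, hmax⟩ := (Metric.isCompact_of_isClosed_isBounded M.prod_closed hb).exists_isMaxOn
      ⟨0, M.zero_mem_prod⟩ hcont
    exact ⟨a, ha, fun b hb => hmax hb⟩
  · have hev : ∀ᶠ a in cocompact ℝ ⊓ 𝓟 A, a * z - C a ≤ 0 * z - C 0 := by
      have h1 := (M.cost_coercive hb).eventually_ge_atTop (z + 1)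
      have h2 : ∀ᶠ a in atTop ⊓ 𝓟 A, max 1 (C 0) ≤ a :=
        (eventually_ge_atTop _).filter_mono inf_le_left
      have h3 : ∀ᶠ a in (atTop : Filter ℝ), a ∈ A → a * z - C a ≤ 0 * z - C 0 := by
        rw [← eventually_inf_principal]
        filter_upwards [h1, h2] with a h1 h2
        have ha : 0 < a := lt_of_lt_of_le one_pos (le_trans (le_max_left _ _) h2)
        rw [le_div_iff₀ ha] at h1
        have := le_trans (le_max_right _ _) h2
        linarith
      rw [eventually_inf_principal, cocompact_eq_atBot_atTop, eventually_sup]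
      refine ⟨?_, h3⟩
      filter_upwards [eventually_lt_atBot (0 : ℝ)] with a ha haA
      exact absurd (M.prod_nonneg haA) (not_le.2 ha)
    obtain ⟨a, ha, hmax⟩ := hcont.exists_isMaxOn' M.prod_closed M.zero_mem_prod hev
    exact ⟨a, ha, fun b hb => hmax hb⟩

theorem exists_optSales (M : Model A Q R C β) (z : ℝ) :
    ∃ q ∈ Q, ∀ b ∈ Q, R b - b * z ≤ R q - q * z := by
  obtain ⟨a, ha, hmax⟩ := M.sales_compact.exists_isMaxOn ⟨0, M.zero_mem_sales⟩
    (M.revenue_cont.sub (continuous_id.mul (continuous_const (y := z))).continuousOn)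
  exact ⟨a, ha, fun b hb => hmax hb⟩

theorem optProd_spec (M : Model A Q R C β) (z : ℝ) :
    optProd A C z ∈ A ∧ ∀ b ∈ A, b * z - C b ≤ optProd A C z * z - C (optProd A C z) :=
  Classical.epsilon_spec (M.exists_optProd z)

theorem optSales_spec (M : Model A Q R C β) (z : ℝ) :
    optSales Q R z ∈ Q ∧ ∀ b ∈ Q, R b - b * z ≤ R (optSales Q R z) - optSales Q R z * z :=
  Classical.epsilon_spec (M.exists_optSales z)

theorem isGreatest_prod (M : Model A Q R C β) (z : ℝ) :
    IsGreatest ((fun a => a * z - C a) '' A) (optProd A C z * z - C (optProd A C z)) := by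
  refine ⟨⟨_, (M.optProd_spec z).1, rfl⟩, ?_⟩
  rintro _ ⟨b, hb, rfl⟩
  exact (M.optProd_spec z).2 b hb

theorem isGreatest_sales (M : Model A Q R C β) (z : ℝ) :
    IsGreatest ((fun q => R q - q * z) '' Q) (R (optSales Q R z) - optSales Q R z * z) := by
  refine ⟨⟨_, (M.optSales_spec z).1, rfl⟩, ?_⟩
  rintro _ ⟨b, hb, rfl⟩
  exact (M.optSales_spec z).2 b hb

theorem hamiltonian_eq (M : Model A Q R C β) (z : ℝ) :
    hamiltonian A Q R C z =
      R (optSales Q R z) - C (optProd A C z) + z * drift A Q R C z := by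
  rw [hamiltonian, Rhat, Chat, (M.isGreatest_prod z).csSup_eq, (M.isGreatest_sales z).csSup_eq,
    drift]
  ring

theorem le_hamiltonian (M : Model A Q R C β) (z : ℝ) {a q : ℝ} (ha : a ∈ A) (hq : q ∈ Q) :
    R q - C a + z * (a - q) ≤ hamiltonian A Q R C z := by
  rw [M.hamiltonian_eq, drift]
  have := (M.optProd_spec z).2 a ha
  have := (M.optSales_spec z).2 q hq
  linarith

theorem subgradient (M : Model A Q R C β) (z w : ℝ) :
    hamiltonian A Q R C z + drift A Q R C z * (w - z) ≤ hamiltonian A Q R C w := by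
  have := M.le_hamiltonian w (M.optProd_spec z).1 (M.optSales_spec z).1
  rw [M.hamiltonian_eq z]
  rw [drift] at *
  linarith

theorem optProd_mono (M : Model A Q R C β) : Monotone (optProd A C) := by
  intro z w hzw
  rcases hzw.eq_or_lt with rfl | hlt
  · rfl
  have h1 := (M.optProd_spec z).2 _ (M.optProd_spec w).1
  have h2 := (M.optProd_spec w).2 _ (M.optProd_spec z).1
  by_contra! hcon
  nlinarith [mul_pos (sub_pos.2 hcon) (sub_pos.2 hlt)]

theorem optSales_anti (M : Model A Q R C β) : Antitone (optSales Q R) := by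
  intro z w hzw
  rcases hzw.eq_or_lt with rfl | hlt
  · rfl
  have h1 := (M.optSales_spec z).2 _ (M.optSales_spec w).1
  have h2 := (M.optSales_spec w).2 _ (M.optSales_spec z).1
  by_contra! hcon
  nlinarith [mul_pos (sub_pos.2 hcon) (sub_pos.2 hlt)]

theorem drift_mono (M : Model A Q R C β) : Monotone (drift A Q R C) :=
  fun _ _ h => sub_le_sub (M.optProd_mono h) (M.optSales_anti h)

theorem hasDerivAt_hamiltonian (M : Model A Q R C β) {z : ℝ}
    (hz : ContinuousAt (drift A Q R C) z) :
    HasDerivAt (hamiltonian A Q R C) (drift A Q R C z) z := by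
  rw [← hasDerivWithinAt_univ]
  exact hasDerivWithinAt_of_subgradient (mem_univ z) (fun z _ w _ => M.subgradient z w)
    hz.continuousWithinAt

theorem countable_drift (M : Model A Q R C β) :
    {z | ¬ ContinuousAt (drift A Q R C) z}.Countable :=
  M.drift_mono.countable_not_continuousAt

theorem convexOn_hamiltonian (M : Model A Q R C β) :
    ConvexOn ℝ univ (hamiltonian A Q R C) := by
  refine ⟨convex_univ, fun x _ y _ a b ha hb hab => ?_⟩
  have h1 := M.subgradient (a • x + b • y) x
  have h2 := M.subgradient (a • x + b • y) y
  simp only [smul_eq_mul] at *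
  obtain rfl : b = 1 - a := by linarith
  nlinarith [mul_le_mul_of_nonneg_left h1 ha, mul_le_mul_of_nonneg_left h2 hb]

theorem continuous_hamiltonian (M : Model A Q R C β) : Continuous (hamiltonian A Q R C) :=
  continuousOn_univ.1 (M.convexOn_hamiltonian.continuousOn isOpen_univ)

/-! ### The least minimum point -/

theorem minPoints_nonneg (M : Model A Q R C β) {z : ℝ} (hz : z ∈ minPoints A Q R C) : 0 ≤ z := by
  by_contra! hneg
  have h0 := hz 0
  -- For `z ≤ 0` the cheapest production is `0`, so only `Rhat` varies there.
  have hR : R (optSales Q R 0) - C 0 = hamiltonian A Q R C 0 := by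
    refine le_antisymm ?_ ?_
    · simpa using M.le_hamiltonian 0 M.zero_mem_prod (M.optSales_spec 0).1
    · rw [M.hamiltonian_eq]
      have := M.cost_mono M.zero_mem_prod (M.optProd_spec 0).1 (M.prod_nonneg (M.optProd_spec 0).1)
      linarith
  have hq0 : optSales Q R 0 = 0 := by
    have h1 := M.le_hamiltonian z M.zero_mem_prod (M.optSales_spec 0).1
    have h2 : 0 ≤ optSales Q R 0 := M.sales_nonneg (M.optSales_spec 0).1
    by_contra hne
    have h3 := mul_neg_of_pos_of_neg (lt_of_le_of_ne h2 (Ne.symm hne)) hneg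
    linarith
  obtain ⟨q, hq, hq1⟩ := M.sales_nontrivial
  have h1 := M.le_hamiltonian z M.zero_mem_prod hq
  have h2 := M.revenue_nonneg q hq
  rw [hq0, M.revenue_zero] at hR
  have h3 := mul_neg_of_pos_of_neg (lt_of_le_of_ne (M.sales_nonneg hq) (Ne.symm hq1)) hneg
  linarith

theorem minPoints_nonempty (M : Model A Q R C β) : (minPoints A Q R C).Nonempty := by
  obtain ⟨q, hq, hq1⟩ := M.sales_nontrivial
  obtain ⟨a, ha, ha1⟩ := M.prod_nontrivial
  have hq0 : 0 < q := lt_of_le_of_ne (M.sales_nonneg hq) (Ne.symm hq1)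
  have ha0 : 0 < a := lt_of_le_of_ne (M.prod_nonneg ha) (Ne.symm ha1)
  have hlim : Tendsto (hamiltonian A Q R C) (cocompact ℝ) atTop := by
    rw [cocompact_eq_atBot_atTop, tendsto_sup]
    constructor
    · refine tendsto_atTop_mono (f := fun z => (-q) * z + (R q - C 0))
        (fun z => ?_) (tendsto_atTop_add_const_right _ _
          (tendsto_id.const_mul_atBot_of_neg (neg_neg_of_pos hq0)))
      have := M.le_hamiltonian z M.zero_mem_prod hq
      linarith
    · refine tendsto_atTop_mono (f := fun z => a * z + (R 0 - C a))
        (fun z => ?_) (tendsto_atTop_add_const_right _ _ (tendsto_id.const_mul_atTop ha0))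
      have := M.le_hamiltonian z ha M.zero_mem_sales
      linarith
  obtain ⟨z, hz⟩ := M.continuous_hamiltonian.exists_forall_le hlim
  exact ⟨z, hz⟩

theorem isLeast_zeta (M : Model A Q R C β) : IsLeast (minPoints A Q R C) (zeta A Q R C) := by
  have hclosed : IsClosed (minPoints A Q R C) := by
    have : minPoints A Q R C = ⋂ w, {z | hamiltonian A Q R C z ≤ hamiltonian A Q R C w} := by
      ext z
      simp [minPoints]
    rw [this]
    exact isClosed_iInter fun w => isClosed_le M.continuous_hamiltonian continuous_const
  exact hclosed.isLeast_csInf M.minPoints_nonempty ⟨0, fun z hz => M.minPoints_nonneg hz⟩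

theorem hamiltonian_zeta_le (M : Model A Q R C β) (z : ℝ) :
    hamiltonian A Q R C (zeta A Q R C) ≤ hamiltonian A Q R C z :=
  M.isLeast_zeta.1 z

theorem zeta_nonneg (M : Model A Q R C β) : 0 ≤ zeta A Q R C :=
  M.minPoints_nonneg M.isLeast_zeta.1

/-- To the left of the least minimum point the net production is negative. -/
theorem drift_neg (M : Model A Q R C β) {z : ℝ} (hz : z < zeta A Q R C) :
    drift A Q R C z < 0 := by
  have h1 : hamiltonian A Q R C (zeta A Q R C) < hamiltonian A Q R C z := by
    refine lt_of_le_of_ne (M.hamiltonian_zeta_le z) fun heq => ?_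
    exact absurd (M.isLeast_zeta.2 fun w => heq ▸ M.hamiltonian_zeta_le w) (not_le.2 hz)
  have h2 := M.subgradient z (zeta A Q R C)
  by_contra! hcon
  nlinarith [mul_nonneg hcon (sub_pos.2 hz).le]

theorem drift_nonneg (M : Model A Q R C β) {z : ℝ} (hz : zeta A Q R C < z) :
    0 ≤ drift A Q R C z := by
  have h1 := M.hamiltonian_zeta_le z
  have h2 := M.subgradient z (zeta A Q R C)
  by_contra! hcon
  nlinarith [mul_pos (neg_pos.2 hcon) (sub_pos.2 hz)]

end Model
end Firm

/-! ### The function `Psi` and its inverse -/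

namespace Firm
namespace Model

variable {A Q : Set ℝ} {R C : ℝ → ℝ} {β : ℝ}

theorem intervalIntegrable_drift_div (M : Model A Q R C β) {p r : ℝ} (hp : 0 < p) (hr : 0 < r) :
    IntervalIntegrable (fun z => drift A Q R C z / (β * z)) volume p r := by
  simp only [div_eq_mul_inv]
  refine M.drift_mono.intervalIntegrable.mul_continuousOn ?_
  refine ContinuousOn.inv₀ (by fun_prop) fun z hz => ?_
  have : 0 < z := lt_of_lt_of_le (lt_min hp hr) hz.1
  have := M.beta_pos
  positivity

theorem intervalIntegrable_neg_drift_div (M : Model A Q R C β) {p r : ℝ} (hp : 0 < p)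
    (hr : 0 < r) :
    IntervalIntegrable (fun z => -(drift A Q R C z) / (β * z)) volume p r := by
  simp only [neg_div]
  exact (M.intervalIntegrable_drift_div hp hr).neg

theorem psiIntegrand_ae_eq (M : Model A Q R C β) :
    psiIntegrand A Q R C β =ᵐ[volume] fun z => drift A Q R C z / (β * z) := by
  filter_upwards [compl_mem_ae_iff.2 (M.countable_drift.measure_zero volume)] with z hz
  rw [psiIntegrand, (M.hasDerivAt_hamiltonian (not_not.1 hz)).deriv]

theorem intervalIntegrable_psiIntegrand (M : Model A Q R C β) {p r : ℝ} (hp : 0 < p) (hr : 0 < r) :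
    IntervalIntegrable (psiIntegrand A Q R C β) volume p r :=
  (M.intervalIntegrable_drift_div hp hr).congr_ae (ae_restrict_of_ae M.psiIntegrand_ae_eq.symm)

theorem Psi_eq (M : Model A Q R C β) (p : ℝ) :
    Psi A Q R C β p = -∫ z in p..(zeta A Q R C), drift A Q R C z / (β * z) := by
  rw [Psi, intervalIntegral.integral_congr_ae]
  filter_upwards [M.psiIntegrand_ae_eq] with z hz _ using hz

theorem Psi_zeta : Psi A Q R C β (zeta A Q R C) = 0 := by
  simp [Psi]

theorem Psi_sub (M : Model A Q R C β) {p r : ℝ} (hp : 0 < p) (hr : 0 < r)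
    (hζ : 0 < zeta A Q R C) :
    Psi A Q R C β p - Psi A Q R C β r = ∫ z in p..r, -(drift A Q R C z) / (β * z) := by
  rw [M.Psi_eq, M.Psi_eq, ← intervalIntegral.integral_add_adjacent_intervals
    (M.intervalIntegrable_drift_div hp hr) (M.intervalIntegrable_drift_div hr hζ)]
  simp only [neg_div, intervalIntegral.integral_neg]
  ring

theorem Psi_antitoneOn (M : Model A Q R C β) (hζ : 0 < zeta A Q R C) :
    AntitoneOn (Psi A Q R C β) (Ioc 0 (zeta A Q R C)) := by
  intro p hp r hr hpr
  rw [← sub_nonneg, M.Psi_sub hp.1 hr.1 hζ]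
  have h0 : ∫ z in p..r, (0 : ℝ) ≤ ∫ z in p..r, -(drift A Q R C z) / (β * z) := by
    refine intervalIntegral.integral_mono_on_of_le_Ioo hpr (by simp) ?_ fun z hz => ?_
    · exact M.intervalIntegrable_neg_drift_div hp.1 hr.1
    · have h1 := M.drift_neg (hz.2.trans_le hr.2)
      have h2 := M.beta_pos
      have h3 := hp.1.trans hz.1
      exact div_nonneg (by linarith) (by positivity)
  simpa using h0

/-- `Psi` is expanding away from `zeta`, so its inverse is Lipschitz away from `0`. -/
theorem le_Psi_sub (M : Model A Q R C β) {p r : ℝ} (hp : 0 < p) (hpr : p ≤ r)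
    (hr : r < zeta A Q R C) :
    -(drift A Q R C r) / (β * zeta A Q R C) * (r - p) ≤ Psi A Q R C β p - Psi A Q R C β r := by
  have hr0 : 0 < r := hp.trans_le hpr
  rw [M.Psi_sub hp hr0 (hr0.trans hr)]
  have h0 : ∫ z in p..r, -(drift A Q R C r) / (β * zeta A Q R C) ≤
      ∫ z in p..r, -(drift A Q R C z) / (β * z) := by
    refine intervalIntegral.integral_mono_on hpr (by simp) ?_ fun z hz => ?_
    · exact M.intervalIntegrable_neg_drift_div hp hr0
    · have h1 := M.drift_neg hr
      have h2 := M.beta_pos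
      have h3 := hp.trans_le hz.1
      have h4 := M.drift_mono hz.2
      have h5 := hz.2.trans hr.le
      exact div_le_div₀ (by linarith) (by linarith) (by positivity) (by gcongr)
  rw [intervalIntegral.integral_const, smul_eq_mul] at h0
  linarith

/-- `Psi` is Lipschitz away from `0`. -/
theorem Psi_sub_le (M : Model A Q R C β) {p r : ℝ} (hp : 0 < p) (hpr : p ≤ r)
    (hr : r ≤ zeta A Q R C) :
    Psi A Q R C β p - Psi A Q R C β r ≤ -(drift A Q R C 0) / (β * p) * (r - p) := by
  have hr0 : 0 < r := hp.trans_le hpr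
  rw [M.Psi_sub hp hr0 (hr0.trans_le hr)]
  have h0 : ∫ z in p..r, -(drift A Q R C z) / (β * z) ≤
      ∫ z in p..r, -(drift A Q R C 0) / (β * p) := by
    refine intervalIntegral.integral_mono_on hpr ?_ (by simp) fun z hz => ?_
    · exact M.intervalIntegrable_neg_drift_div hp hr0
    · have h1 := M.drift_neg (hr0.trans_le hr)
      have h2 := M.beta_pos
      have h3 := hp.trans_le hz.1
      have h4 := M.drift_mono h3.le
      exact div_le_div₀ (by linarith) (by linarith) (by positivity) (by gcongr; exact hz.1)
  rw [intervalIntegral.integral_const, smul_eq_mul] at h0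
  linarith

theorem Psi_strictAntiOn (M : Model A Q R C β) (hζ : 0 < zeta A Q R C) :
    StrictAntiOn (Psi A Q R C β) (Ioc 0 (zeta A Q R C)) := by
  intro p hp r hr hpr
  obtain ⟨m, hpm, hmr⟩ := exists_between hpr
  have hm : m < zeta A Q R C := hmr.trans_le hr.2
  have h1 := M.le_Psi_sub hp.1 hpm.le hm
  have h2 := M.Psi_antitoneOn hζ ⟨hp.1.trans hpm, hm.le⟩ hr hmr.le
  have h3 := M.drift_neg hm
  have h4 := M.beta_pos
  have : 0 < -(drift A Q R C m) / (β * zeta A Q R C) * (m - p) :=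
    mul_pos (div_pos (by linarith) (by positivity)) (by linarith)
  linarith

theorem Psi_continuousOn (M : Model A Q R C β) {p : ℝ} (hp : 0 < p) :
    ContinuousOn (Psi A Q R C β) (Icc p (zeta A Q R C)) := by
  rcases lt_or_ge (zeta A Q R C) p with h | h
  · simp [h]
  have hd := M.drift_neg (hp.trans_le h)
  have hβ := M.beta_pos
  have hK : 0 ≤ -(drift A Q R C 0) / (β * p) := div_nonneg (by linarith) (by positivity)
  refine (LipschitzOnWith.of_le_add_mul
    (-(drift A Q R C 0) / (β * p)).toNNReal fun x hx y hy => ?_).continuousOn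
  rw [Real.coe_toNNReal _ hK, Real.dist_eq]
  rcases le_total x y with hxy | hxy
  · have h1 := M.Psi_sub_le (hp.trans_le hx.1) hxy hy.2
    have h2 : -(drift A Q R C 0) / (β * x) ≤ -(drift A Q R C 0) / (β * p) := by
      have := hx.1
      exact div_le_div_of_nonneg_left (by linarith) (by positivity) (by gcongr)
    rw [abs_of_nonpos (by linarith)]
    nlinarith [mul_le_mul_of_nonneg_right h2 (sub_nonneg.2 hxy)]
  · have h1 := M.Psi_antitoneOn (hp.trans_le h) ⟨hp.trans_le hy.1, hy.2⟩
      ⟨hp.trans_le hx.1, hx.2⟩ hxy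
    have := mul_nonneg hK (abs_nonneg (x - y))
    linarith

/-- `Psi` grows at least logarithmically at `0`. -/
theorem exists_le_Psi (M : Model A Q R C β) (hζ : 0 < zeta A Q R C) (y : ℝ) :
    ∃ p ∈ Ioc 0 (zeta A Q R C), y ≤ Psi A Q R C β p := by
  set ζ := zeta A Q R C
  have hβ := M.beta_pos
  have hc : drift A Q R C (ζ / 2) < 0 := M.drift_neg (half_lt_self hζ)
  set c := -(drift A Q R C (ζ / 2)) / β
  have hc0 : 0 < c := div_pos (by linarith) hβ
  -- `p` is chosen so that the lower bound `c * log (ζ / (2 * p))` of `Psi p` equals `|y|`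
  refine ⟨ζ / 2 * Real.exp (-(|y| / c)), ⟨by positivity, ?_⟩, ?_⟩
  · have : Real.exp (-(|y| / c)) ≤ 1 := Real.exp_le_one_iff.2 (neg_nonpos.2 (by positivity))
    nlinarith
  set p := ζ / 2 * Real.exp (-(|y| / c)) with hp
  have hp0 : 0 < p := by positivity
  have hpζ : p ≤ ζ / 2 := by
    have : Real.exp (-(|y| / c)) ≤ 1 := Real.exp_le_one_iff.2 (neg_nonpos.2 (by positivity))
    nlinarith
  have h1 := M.Psi_sub hp0 (half_pos hζ) hζ
  have h2 : 0 ≤ Psi A Q R C β (ζ / 2) := by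
    have := M.Psi_antitoneOn hζ ⟨half_pos hζ, (half_lt_self hζ).le⟩ ⟨hζ, le_rfl⟩
      (half_lt_self hζ).le
    rwa [Psi_zeta] at this
  have h3 : ∫ z in p..(ζ / 2), c * z⁻¹ ≤ ∫ z in p..(ζ / 2), -(drift A Q R C z) / (β * z) := by
    have hne : ∀ z ∈ uIcc p (ζ / 2), z ≠ 0 := fun z hz => by
      rw [uIcc_of_le hpζ] at hz
      exact (hp0.trans_le hz.1).ne'
    refine intervalIntegral.integral_mono_on hpζ
      ((intervalIntegral.intervalIntegrable_inv hne continuousOn_id).const_mul c) ?_ fun z hz => ?_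
    · exact M.intervalIntegrable_neg_drift_div hp0 (half_pos hζ)
    · have h4 := M.drift_mono hz.2
      have h5 := hp0.trans_le hz.1
      rw [← div_eq_mul_inv, div_div]
      gcongr
  rw [intervalIntegral.integral_const_mul, integral_inv_of_pos hp0 (half_pos hζ)] at h3
  have h4 : Real.log (ζ / 2 / p) = |y| / c := by
    rw [hp, Real.log_div (by positivity) (by positivity), Real.log_mul (by positivity)
      (by positivity), Real.log_exp]
    ring
  rw [h4, mul_div_cancel₀ _ hc0.ne'] at h3
  linarith [le_abs_self y]

theorem Psi_bijOn (M : Model A Q R C β) (hζ : 0 < zeta A Q R C) :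
    BijOn (Psi A Q R C β) (Ioc 0 (zeta A Q R C)) (Ici 0) := by
  refine ⟨fun p hp => ?_, (M.Psi_strictAntiOn hζ).injOn, fun y hy => ?_⟩
  · have := M.Psi_antitoneOn hζ hp ⟨hζ, le_rfl⟩ hp.2
    rwa [Psi_zeta] at this
  · obtain ⟨p, hp, hpy⟩ := M.exists_le_Psi hζ y
    obtain ⟨r, hr, rfl⟩ := intermediate_value_Icc' hp.2 (M.Psi_continuousOn hp.1)
      (show y ∈ Icc _ _ from ⟨by rw [Psi_zeta]; exact hy, hpy⟩)
    exact ⟨r, ⟨hp.1.trans_le hr.1, hr.2⟩, rfl⟩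

theorem xi_mem (M : Model A Q R C β) (hζ : 0 < zeta A Q R C) {x : ℝ} (hx : 0 ≤ x) :
    xi A Q R C β x ∈ Ioc 0 (zeta A Q R C) :=
  (M.Psi_bijOn hζ).surjOn.mapsTo_invFunOn hx

theorem Psi_xi (M : Model A Q R C β) (hζ : 0 < zeta A Q R C) {x : ℝ} (hx : 0 ≤ x) :
    Psi A Q R C β (xi A Q R C β x) = x :=
  (M.Psi_bijOn hζ).surjOn.rightInvOn_invFunOn hx

theorem xi_zero (M : Model A Q R C β) (hζ : 0 < zeta A Q R C) :
    xi A Q R C β 0 = zeta A Q R C :=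
  (M.Psi_bijOn hζ).injOn (M.xi_mem hζ le_rfl) ⟨hζ, le_rfl⟩
    ((M.Psi_xi hζ le_rfl).trans Psi_zeta.symm)

theorem xi_lt_iff (M : Model A Q R C β) (hζ : 0 < zeta A Q R C) {x p : ℝ} (hx : 0 ≤ x)
    (hp : p ∈ Ioc 0 (zeta A Q R C)) : xi A Q R C β x < p ↔ Psi A Q R C β p < x := by
  conv_rhs => rw [← M.Psi_xi hζ hx]
  exact ((M.Psi_strictAntiOn hζ).lt_iff_gt hp (M.xi_mem hζ hx)).symm

theorem lt_xi_iff (M : Model A Q R C β) (hζ : 0 < zeta A Q R C) {x p : ℝ} (hx : 0 ≤ x)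
    (hp : p ∈ Ioc 0 (zeta A Q R C)) : p < xi A Q R C β x ↔ x < Psi A Q R C β p := by
  conv_rhs => rw [← M.Psi_xi hζ hx]
  exact ((M.Psi_strictAntiOn hζ).lt_iff_gt (M.xi_mem hζ hx) hp).symm

theorem xi_strictAntiOn (M : Model A Q R C β) (hζ : 0 < zeta A Q R C) :
    StrictAntiOn (xi A Q R C β) (Ici 0) := by
  intro x hx y hy hxy
  rw [M.xi_lt_iff hζ hy (M.xi_mem hζ hx), M.Psi_xi hζ hx]
  exact hxy

theorem xi_lt_zeta (M : Model A Q R C β) (hζ : 0 < zeta A Q R C) {x : ℝ} (hx : 0 < x) :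
    xi A Q R C β x < zeta A Q R C := by
  rw [M.xi_lt_iff hζ hx.le ⟨hζ, le_rfl⟩, Psi_zeta]
  exact hx

/-- `xi` is Lipschitz away from `0`. -/
theorem xi_sub_le (M : Model A Q R C β) (hζ : 0 < zeta A Q R C) {d : ℝ} (hd : 0 < d) :
    ∃ L : ℝ, 0 < L ∧ ∀ x y, d ≤ x → x ≤ y →
      xi A Q R C β x - xi A Q R C β y ≤ L * (y - x) := by
  set c := -(drift A Q R C (xi A Q R C β d)) / (β * zeta A Q R C)
  have hβ := M.beta_pos
  have hc : 0 < c := div_pos (by linarith [M.drift_neg (M.xi_lt_zeta hζ hd)]) (by positivity)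
  refine ⟨c⁻¹, inv_pos.2 hc, fun x y hdx hxy => ?_⟩
  have hx : 0 < x := hd.trans_le hdx
  have hy : 0 < y := hx.trans_le hxy
  have hanti := (M.xi_strictAntiOn hζ).antitoneOn
  have h1 := M.le_Psi_sub (M.xi_mem hζ hy.le).1 (hanti hx.le hy.le hxy) (M.xi_lt_zeta hζ hx)
  rw [M.Psi_xi hζ hx.le, M.Psi_xi hζ hy.le] at h1
  have h2 := M.drift_mono (hanti hd.le hx.le hdx)
  have h3 : c ≤ -(drift A Q R C (xi A Q R C β x)) / (β * zeta A Q R C) := by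
    exact div_le_div_of_nonneg_right (neg_le_neg h2) (by positivity)
  have h4 := mul_le_mul_of_nonneg_right h3 (sub_nonneg.2 (hanti hx.le hy.le hxy))
  rw [← div_eq_inv_mul, le_div_iff₀ hc]
  linarith

/-- `xi` is locally bounded below in slope, hence has no critical points. -/
theorem le_xi_sub (M : Model A Q R C β) (hζ : 0 < zeta A Q R C) {b : ℝ} (hb : 0 ≤ b) :
    ∃ l : ℝ, 0 < l ∧ ∀ x y, 0 ≤ x → x ≤ y → y ≤ b →
      l * (y - x) ≤ xi A Q R C β x - xi A Q R C β y := by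
  set K := -(drift A Q R C 0) / (β * xi A Q R C β b)
  have hβ := M.beta_pos
  have hb0 := (M.xi_mem hζ hb).1
  have hK : 0 < K := div_pos (by linarith [M.drift_neg hζ]) (by positivity)
  refine ⟨K⁻¹, inv_pos.2 hK, fun x y hx hxy hyb => ?_⟩
  have hy : 0 ≤ y := hx.trans hxy
  have hanti := (M.xi_strictAntiOn hζ).antitoneOn
  have h1 := M.Psi_sub_le (M.xi_mem hζ hy).1 (hanti hx hy hxy) (M.xi_mem hζ hx).2
  rw [M.Psi_xi hζ hx, M.Psi_xi hζ hy] at h1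
  have h3 : -(drift A Q R C 0) / (β * xi A Q R C β y) ≤ K := by
    have := hanti hy hb hyb
    have := M.drift_neg hζ
    exact div_le_div_of_nonneg_left (by linarith) (by positivity) (by gcongr)
  have h4 := mul_le_mul_of_nonneg_right h3 (sub_nonneg.2 (hanti hx hy hxy))
  rw [← div_eq_inv_mul, div_le_iff₀ hK]
  linarith

theorem xi_continuousOn (M : Model A Q R C β) (hζ : 0 < zeta A Q R C) :
    ContinuousOn (xi A Q R C β) (Ici 0) := by
  intro x hx
  rcases (show (0 : ℝ) ≤ x from hx).eq_or_lt with rfl | hx0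
  · rw [ContinuousWithinAt, M.xi_zero hζ, tendsto_order]
    constructor
    · intro a ha
      obtain ⟨p, hp, hpζ⟩ := exists_between (max_lt ha hζ)
      have hpm : p ∈ Ioc 0 (zeta A Q R C) := ⟨(le_max_right _ _).trans_lt hp, hpζ.le⟩
      have hpos : 0 < Psi A Q R C β p := by
        simpa [Psi_zeta] using M.Psi_strictAntiOn hζ hpm ⟨hζ, le_rfl⟩ hpζ
      filter_upwards [self_mem_nhdsWithin, mem_nhdsWithin_of_mem_nhds (Iio_mem_nhds hpos)]
        with y hy hyp
      exact ((le_max_left _ _).trans_lt hp).trans ((M.lt_xi_iff hζ hy hpm).2 hyp)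
    · intro a ha
      filter_upwards [self_mem_nhdsWithin] with y hy
      exact (M.xi_mem hζ hy).2.trans_lt ha
  · obtain ⟨L, hL, hLip⟩ := M.xi_sub_le hζ (half_pos hx0)
    have hc : ContinuousOn (xi A Q R C β) (Ici (x / 2)) := by
      refine (LipschitzOnWith.of_le_add_mul L.toNNReal fun u hu w hw => ?_).continuousOn
      rw [Real.coe_toNNReal _ hL.le, Real.dist_eq]
      rcases le_total u w with h | h
      · have := hLip u w hu h
        rw [abs_of_nonpos (by linarith)]
        linarith
      · have h0 : 0 ≤ w := (half_pos hx0).le.trans hw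
        have := (M.xi_strictAntiOn hζ).antitoneOn h0 (h0.trans h) h
        have := mul_nonneg hL.le (abs_nonneg (u - w))
        linarith
    exact (hc.continuousAt (Ici_mem_nhds (by linarith))).continuousWithinAt

theorem tendsto_xi (M : Model A Q R C β) (hζ : 0 < zeta A Q R C) :
    Tendsto (xi A Q R C β) atTop (𝓝 0) := by
  rw [tendsto_order]
  constructor
  · intro a ha
    filter_upwards [eventually_ge_atTop 0] with x hx using ha.trans (M.xi_mem hζ hx).1
  · intro a ha
    have hp : min a (zeta A Q R C) ∈ Ioc 0 (zeta A Q R C) := ⟨lt_min ha hζ, min_le_right _ _⟩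
    filter_upwards [eventually_gt_atTop (Psi A Q R C β (min a (zeta A Q R C))),
      eventually_ge_atTop 0] with x hx hx0
    exact ((M.xi_lt_iff hζ hx0 hp).2 hx).trans_le (min_le_left _ _)

/-- The inverse of `Psi` need not be Lipschitz at `0`; it is absolutely continuous because it is
Lipschitz away from `0` and its total decrease near `0` is small. -/
theorem absContOn_xi (M : Model A Q R C β) (hζ : 0 < zeta A Q R C) :
    AbsContOn (xi A Q R C β) (Ici 0) := by
  intro ε hε
  have hanti := (M.xi_strictAntiOn hζ).antitoneOn
  obtain ⟨d, hd, hdε⟩ : ∃ d : ℝ, 0 < d ∧ xi A Q R C β 0 - xi A Q R C β d < ε / 2 := by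
    have h0 := (M.xi_continuousOn hζ 0 (mem_Ici.2 le_rfl)).mono Ioi_subset_Ici_self
    have h1 : ∀ᶠ d in 𝓝[>] (0 : ℝ), xi A Q R C β 0 - ε / 2 < xi A Q R C β d :=
      h0.tendsto.eventually (lt_mem_nhds (by linarith))
    obtain ⟨d, hd, hd0⟩ := (h1.and self_mem_nhdsWithin).exists
    exact ⟨d, hd0, by linarith⟩
  obtain ⟨L, hL, hLip⟩ := M.xi_sub_le hζ hd
  refine ⟨ε / (2 * L), by positivity, fun k a b hab hdisj hsum => ?_⟩
  have ha : ∀ i, 0 ≤ a i := fun i => (hab i).2 ⟨le_rfl, (hab i).1.le⟩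
  -- `g` is `xi` stopped at `d`
  set g : ℝ → ℝ := fun x => xi A Q R C β (min x d)
  have hg : ∀ x y, 0 ≤ x → x ≤ y → g y ≤ g x := fun x y hx hxy =>
    hanti (le_min hx hd.le) (le_min (hx.trans hxy) hd.le) (min_le_min_right _ hxy)
  have h1 : ∀ i, |xi A Q R C β (b i) - xi A Q R C β (a i)| ≤
      (g (a i) - g (b i)) + L * (b i - a i) := by
    intro i
    have hi := (hab i).1
    have hab' := hanti (ha i) ((ha i).trans hi.le) hi.le
    rw [abs_sub_comm, abs_of_nonneg (sub_nonneg.2 hab')]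
    rcases le_total (b i) d with h | h
    · simp only [g, min_eq_left h, min_eq_left (hi.le.trans h)]
      have := mul_nonneg hL.le (sub_nonneg.2 hi.le)
      linarith
    · rcases le_total (a i) d with h' | h'
      · simp only [g, min_eq_right h, min_eq_left h']
        have h2 := hLip d (b i) le_rfl h
        have h3 := mul_le_mul_of_nonneg_left (sub_le_sub_left h' (b i)) hL.le
        linarith
      · simp only [g, min_eq_right h, min_eq_right h']
        have := hLip (a i) (b i) h' hi.le
        linarith
  -- the images of the intervals under `g` are disjoint intervals in `[xi d, xi 0]`
  have h2 : ∑ i, (g (a i) - g (b i)) ≤ xi A Q R C β 0 - xi A Q R C β d := by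
    have hdis : Pairwise (Function.onFun Disjoint fun i => Ioo (g (b i)) (g (a i))) := by
      intro i j hij
      have hor : b i ≤ a j ∨ b j ≤ a i := by
        by_contra! hcon
        have := hdisj i j hij
        rw [Set.disjoint_left] at this
        obtain ⟨m, hm1, hm2⟩ := exists_between (max_lt (lt_min (hab i).1 hcon.2)
          (lt_min hcon.1 (hab j).1))
        simp only [max_lt_iff, lt_min_iff] at hm1 hm2
        exact this ⟨hm1.1, hm2.1⟩ ⟨hm1.2, hm2.2⟩
      rw [Function.onFun, Set.disjoint_left]
      rintro y ⟨hy1, hy2⟩ ⟨hy3, hy4⟩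
      rcases hor with h | h
      · have := hg _ _ ((ha i).trans (hab i).1.le) h
        linarith
      · have := hg _ _ ((ha j).trans (hab j).1.le) h
        linarith
    have hm : volume (⋃ i, Ioo (g (b i)) (g (a i))) ≤ volume (Icc (g d) (g 0)) := by
      refine measure_mono (iUnion_subset fun i y hy => ⟨?_, ?_⟩)
      · refine le_trans ?_ hy.1.le
        simp only [g, min_self]
        exact hanti (le_min ((ha i).trans (hab i).1.le) hd.le) hd.le (min_le_right _ _)
      · exact hy.2.le.trans (hg 0 _ le_rfl (ha i))
    rw [measure_iUnion hdis fun i => measurableSet_Ioo, tsum_fintype] at hm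
    simp only [Real.volume_Ioo, Real.volume_Icc] at hm
    rw [← ENNReal.ofReal_sum_of_nonneg
      (fun i _ => sub_nonneg.2 (hg _ _ (ha i) (hab i).1.le))] at hm
    have := (ENNReal.ofReal_le_ofReal_iff (sub_nonneg.2 (hg 0 d le_rfl hd.le))).1 hm
    simpa [g, min_eq_left hd.le] using this
  calc ∑ i, |xi A Q R C β (b i) - xi A Q R C β (a i)|
      ≤ ∑ i, ((g (a i) - g (b i)) + L * (b i - a i)) := Finset.sum_le_sum fun i _ => h1 i
    _ = ∑ i, (g (a i) - g (b i)) + L * ∑ i, (b i - a i) := by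
      rw [Finset.sum_add_distrib, Finset.mul_sum]
    _ < ε / 2 + L * (ε / (2 * L)) :=
      add_lt_add (h2.trans_lt hdε) (mul_lt_mul_of_pos_left hsum hL)
    _ = ε := by
      field_simp
      ring

end Model
end Firm

/-! ### The profit of an admissible strategy -/

namespace Firm

theorem inventory_eq_add {x : ℝ} {α q : ℝ → ℝ} {a b : ℝ}
    (ha : IntervalIntegrable (fun s => α s - q s) volume 0 a)
    (hb : IntervalIntegrable (fun s => α s - q s) volume 0 b) :
    inventory x α q b = inventory x α q a + ∫ s in a..b, (α s - q s) := by
  rw [inventory, inventory, ← intervalIntegral.integral_add_adjacent_intervals ha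
    (ha.symm.trans hb)]
  ring

/-- Integration by parts of the discounted inventory flow. -/
theorem integral_exp_mul_flow {x β : ℝ} {α q : ℝ → ℝ} {a b : ℝ} (ha : 0 ≤ a) (hab : a ≤ b)
    (hf : IntervalIntegrable (fun s => α s - q s) volume 0 b) :
    ∫ t in a..b, Real.exp (-β * t) * (α t - q t) =
      Real.exp (-β * b) * inventory x α q b - Real.exp (-β * a) * inventory x α q a +
        β * ∫ t in a..b, Real.exp (-β * t) * inventory x α q t := by
  have hfa : IntervalIntegrable (fun s => α s - q s) volume 0 a :=
    hf.mono_set (by rw [uIcc_of_le ha, uIcc_of_le (ha.trans hab)]; exact Icc_subset_Icc_right hab)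
  have hfab : IntervalIntegrable (fun s => α s - q s) volume a b := hfa.symm.trans hf
  have hexp : AbsolutelyContinuousOnInterval (fun t => Real.exp (-β * t)) a b :=
    ContDiffOn.absolutelyContinuousOnInterval (by fun_prop)
  have hX0 := hfab.absolutelyContinuousOnInterval_intervalIntegral (c := a) left_mem_uIcc
  have hconst : AbsolutelyContinuousOnInterval (fun _ => inventory x α q a) a b :=
    ContDiffOn.absolutelyContinuousOnInterval (by fun_prop)
  have hX : AbsolutelyContinuousOnInterval
      (fun t => inventory x α q a + ∫ s in a..t, (α s - q s)) a b := hconst.add hX0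
  have hibp := hexp.integral_mul_deriv_eq_deriv_mul hX
  have hinv : ∀ t ∈ uIcc a b,
      inventory x α q a + ∫ s in a..t, (α s - q s) = inventory x α q t := fun t ht => by
    rw [uIcc_of_le hab] at ht
    refine (inventory_eq_add hfa (hf.mono_set ?_)).symm
    rw [uIcc_of_le (ha.trans ht.1), uIcc_of_le (ha.trans hab)]
    exact Icc_subset_Icc_right ht.2
  have h1 : ∫ t in a..b, Real.exp (-β * t) *
      deriv (fun t => inventory x α q a + ∫ s in a..t, (α s - q s)) t =
        ∫ t in a..b, Real.exp (-β * t) * (α t - q t) := by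
    refine intervalIntegral.integral_congr_ae ?_
    filter_upwards [hfab.ae_hasDerivAt_integral] with t ht htm
    rw [((ht (uIoc_subset_uIcc htm) a left_mem_uIcc).const_add _).deriv]
  have h2 : ∫ t in a..b, deriv (fun t => Real.exp (-β * t)) t *
      (inventory x α q a + ∫ s in a..t, (α s - q s)) =
        -(β * ∫ t in a..b, Real.exp (-β * t) * inventory x α q t) := by
    rw [← intervalIntegral.integral_const_mul, ← intervalIntegral.integral_neg]
    refine intervalIntegral.integral_congr fun t ht => ?_
    have hd : HasDerivAt (fun t => Real.exp (-β * t)) (Real.exp (-β * t) * (-β * 1)) t :=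
      ((hasDerivAt_id t).const_mul (-β)).exp
    simp only [hd.deriv, hinv t ht]
    ring
  rw [h1, h2, hinv b right_mem_uIcc, hinv a left_mem_uIcc] at hibp
  rw [hibp]
  ring

theorem integral_exp_neg {β : ℝ} (hβ : β ≠ 0) (a b : ℝ) :
    ∫ t in a..b, Real.exp (-β * t) = (Real.exp (-β * a) - Real.exp (-β * b)) / β := by
  have : ∀ t ∈ uIcc a b, HasDerivAt (fun t => -Real.exp (-β * t) / β) (Real.exp (-β * t)) t := by
    intro t _
    have := (((hasDerivAt_id t).const_mul (-β)).exp.neg.div_const β)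
    simpa [hβ] using this
  rw [intervalIntegral.integral_eq_sub_of_hasDerivAt this
    (Continuous.intervalIntegrable (by fun_prop) _ _)]
  ring

theorem tendsto_exp_neg {β : ℝ} (hβ : 0 < β) :
    Tendsto (fun T : ℝ => Real.exp (-β * T)) atTop (𝓝 0) :=
  Real.tendsto_exp_atBot.comp (tendsto_id.const_mul_atTop_of_neg (neg_neg_of_pos hβ))

/-- The discounted profit rate. -/
noncomputable def gain (R C : ℝ → ℝ) (β : ℝ) (α q : ℝ → ℝ) (t : ℝ) : ℝ :=
  Real.exp (-β * t) * (R (q t) - C (α t))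

theorem aestronglyMeasurable_exp_mul_comp {β : ℝ} {S : Set ℝ} {f g : ℝ → ℝ}
    (hS : IsClosed S) (hf : ContinuousOn f S) (hg : Measurable g)
    (hgS : ∀ t, 0 ≤ t → g t ∈ S) :
    AEStronglyMeasurable (fun t => Real.exp (-β * t) * f (g t)) (volume.restrict (Ioi 0)) := by
  classical
  have h1 : Measurable (S.piecewise f 0) :=
    hf.measurable_piecewise continuous_zero.continuousOn hS.measurableSet
  have h2 : Measurable fun t => Real.exp (-β * t) * S.piecewise f 0 (g t) :=
    (by fun_prop : Measurable fun t : ℝ => Real.exp (-β * t)).mul (h1.comp hg)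
  refine h2.aestronglyMeasurable.congr ?_
  filter_upwards [ae_restrict_mem measurableSet_Ioi] with t ht
  rw [piecewise_eq_of_mem _ _ _ (hgS t (le_of_lt ht))]

theorem intervalIntegrable_gain {R C : ℝ → ℝ} {β : ℝ} {α q : ℝ → ℝ} {a b : ℝ}
    (ha : 0 ≤ a) (hb : 0 ≤ b) (hg : IntegrableOn (gain R C β α q) (Ioi 0)) :
    IntervalIntegrable (gain R C β α q) volume a b := by
  rw [intervalIntegrable_iff]
  exact hg.mono_set fun t ht => (le_min ha hb).trans_lt ht.1

theorem hasDerivAt_costate (β p₀ t : ℝ) :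
    HasDerivAt (fun t => p₀ * Real.exp (β * t)) (β * (p₀ * Real.exp (β * t))) t := by
  have := ((hasDerivAt_id t).const_mul β).exp.const_mul p₀
  simp only [id, mul_one] at this
  exact this.congr_deriv (by ring)

namespace Model

variable {A Q : Set ℝ} {R C : ℝ → ℝ} {β : ℝ} {α q : ℝ → ℝ} {x : ℝ}

theorem intervalIntegrable_flow (M : Model A Q R C β) (h : Admissible A Q x α q) {t : ℝ}
    (ht : 0 ≤ t) : IntervalIntegrable (fun s => α s - q s) volume 0 t := by
  refine (h.intervalIntegrable_prod t ht).sub ?_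
  obtain ⟨K, hK⟩ := M.sales_compact.isBounded.exists_norm_le
  rw [intervalIntegrable_iff, uIoc_of_le ht]
  refine Measure.integrableOn_of_bounded (M := K) measure_Ioc_lt_top.ne
    h.measurable_sales.aestronglyMeasurable ?_
  filter_upwards [ae_restrict_mem measurableSet_Ioc] with s hs
  exact hK _ (h.sales_mem s hs.1.le)

theorem integrableOn_revenue (M : Model A Q R C β) (h : Admissible A Q x α q) :
    IntegrableOn (fun t => Real.exp (-β * t) * R (q t)) (Ioi 0) := by
  obtain ⟨K, hK⟩ := (M.sales_compact.image_of_continuousOn M.revenue_cont).isBounded.exists_norm_le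
  refine ((exp_neg_integrableOn_Ioi 0 M.beta_pos).mul_const K).mono'
    (aestronglyMeasurable_exp_mul_comp M.sales_compact.isClosed M.revenue_cont h.measurable_sales
      h.sales_mem) ?_
  filter_upwards [ae_restrict_mem measurableSet_Ioi] with t ht
  rw [norm_mul, Real.norm_eq_abs, Real.abs_exp]
  gcongr
  exact hK _ ⟨_, h.sales_mem t (le_of_lt ht), rfl⟩

theorem integrableOn_cost (M : Model A Q R C β) (h : Admissible A Q x α q) {K : ℝ}
    (hK : ∀ t, 0 ≤ t → C (α t) ≤ K) :
    IntegrableOn (fun t => Real.exp (-β * t) * C (α t)) (Ioi 0) := by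
  refine ((exp_neg_integrableOn_Ioi 0 M.beta_pos).mul_const K).mono'
    (aestronglyMeasurable_exp_mul_comp M.prod_closed M.cost_cont h.measurable_prod h.prod_mem) ?_
  filter_upwards [ae_restrict_mem measurableSet_Ioi] with t ht
  rw [norm_mul, Real.norm_eq_abs, Real.abs_exp, Real.norm_eq_abs,
    abs_of_nonneg (M.cost_nonneg _ (h.prod_mem t (le_of_lt ht)))]
  gcongr
  exact hK _ (le_of_lt ht)

theorem integrableOn_gain (M : Model A Q R C β) (h : Admissible A Q x α q)
    (hc : IntegrableOn (fun t => Real.exp (-β * t) * C (α t)) (Ioi 0)) :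
    IntegrableOn (gain R C β α q) (Ioi 0) := by
  have : gain R C β α q = fun t =>
      Real.exp (-β * t) * R (q t) - Real.exp (-β * t) * C (α t) := by
    ext t
    rw [gain]
    ring
  rw [this]
  exact (M.integrableOn_revenue h).sub hc

theorem profit_eq (M : Model A Q R C β) (h : Admissible A Q x α q)
    (hc : IntegrableOn (fun t => Real.exp (-β * t) * C (α t)) (Ioi 0)) :
    profit R C β α q = ((∫ t in Ioi (0 : ℝ), gain R C β α q t : ℝ) : EReal) := by
  have hr := M.integrableOn_revenue h
  have hr0 : 0 ≤ᵐ[volume.restrict (Ioi 0)] fun t => Real.exp (-β * t) * R (q t) := by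
    filter_upwards [ae_restrict_mem measurableSet_Ioi] with t ht
    exact mul_nonneg (Real.exp_pos _).le (M.revenue_nonneg _ (h.sales_mem t (le_of_lt ht)))
  have hc0 : 0 ≤ᵐ[volume.restrict (Ioi 0)] fun t => Real.exp (-β * t) * C (α t) := by
    filter_upwards [ae_restrict_mem measurableSet_Ioi] with t ht
    exact mul_nonneg (Real.exp_pos _).le (M.cost_nonneg _ (h.prod_mem t (le_of_lt ht)))
  rw [profit, ← ofReal_integral_eq_lintegral_ofReal hr hr0,
    ← ofReal_integral_eq_lintegral_ofReal hc hc0, EReal.coe_ennreal_ofReal,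
    EReal.coe_ennreal_ofReal, max_eq_left (integral_nonneg_of_ae hr0),
    max_eq_left (integral_nonneg_of_ae hc0), ← EReal.coe_sub, ← integral_sub hr hc]
  simp only [gain, mul_sub]

/-- A bound for the profits up to all large times bounds the profit. -/
theorem profit_le_of_eventually_le (M : Model A Q R C β) (h : Admissible A Q x α q) {b : ℝ → ℝ}
    {B : ℝ} (hb : Tendsto b atTop (𝓝 B))
    (hle : IntegrableOn (gain R C β α q) (Ioi 0) →
      ∀ᶠ T in atTop, ∫ t in (0 : ℝ)..T, gain R C β α q t ≤ b T) :
    profit R C β α q ≤ B := by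
  by_cases htop : ∫⁻ t in Ioi (0 : ℝ), ENNReal.ofReal (Real.exp (-β * t) * C (α t)) = ⊤
  · rw [profit, htop, EReal.coe_ennreal_top, EReal.sub_top]
    exact bot_le
  · have hc0 : 0 ≤ᵐ[volume.restrict (Ioi 0)] fun t => Real.exp (-β * t) * C (α t) := by
      filter_upwards [ae_restrict_mem measurableSet_Ioi] with t ht
      exact mul_nonneg (Real.exp_pos _).le (M.cost_nonneg _ (h.prod_mem t (le_of_lt ht)))
    have hc : IntegrableOn (fun t => Real.exp (-β * t) * C (α t)) (Ioi 0) :=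
      ⟨aestronglyMeasurable_exp_mul_comp M.prod_closed M.cost_cont h.measurable_prod h.prod_mem,
        (hasFiniteIntegral_iff_ofReal hc0).2 (lt_top_iff_ne_top.2 htop)⟩
    have hg := M.integrableOn_gain h hc
    rw [M.profit_eq h hc, EReal.coe_le_coe_iff]
    exact le_of_tendsto_of_tendsto (intervalIntegral_tendsto_integral_Ioi 0 hg tendsto_id) hb
      (hle hg)

theorem le_profit_of_eventually_le (M : Model A Q R C β) (h : Admissible A Q x α q) {b : ℝ → ℝ}
    {B K : ℝ} (hK : ∀ t, 0 ≤ t → C (α t) ≤ K) (hb : Tendsto b atTop (𝓝 B))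
    (hle : IntegrableOn (gain R C β α q) (Ioi 0) →
      ∀ᶠ T in atTop, b T ≤ ∫ t in (0 : ℝ)..T, gain R C β α q t) :
    B ≤ profit R C β α q := by
  have hc := M.integrableOn_cost h hK
  have hg := M.integrableOn_gain h hc
  rw [M.profit_eq h hc, EReal.coe_le_coe_iff]
  exact le_of_tendsto_of_tendsto hb (intervalIntegral_tendsto_integral_Ioi 0 hg tendsto_id)
    (hle hg)

theorem gain_le (M : Model A Q R C β) (h : Admissible A Q x α q) {t : ℝ} (ht : 0 ≤ t) (p : ℝ) :
    gain R C β α q t ≤ Real.exp (-β * t) * (hamiltonian A Q R C p - p * (α t - q t)) := by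
  have := M.le_hamiltonian p (h.prod_mem t ht) (h.sales_mem t ht)
  exact mul_le_mul_of_nonneg_left (by linarith) (Real.exp_pos _).le

/-- With the costate `0` the profit rate is at most the Hamiltonian at `0`. -/
theorem profit_le_hamiltonian_zero (M : Model A Q R C β) (h : Admissible A Q x α q) :
    profit R C β α q ≤ ((hamiltonian A Q R C 0 / β : ℝ) : EReal) := by
  have hβ := M.beta_pos
  refine M.profit_le_of_eventually_le h
    (b := fun T => (1 - Real.exp (-β * T)) / β * hamiltonian A Q R C 0) ?_ fun hg => ?_
  · have := (((tendsto_exp_neg hβ).const_sub 1).div_const β).mul_const (hamiltonian A Q R C 0)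
    convert this using 2
    ring
  · filter_upwards [eventually_ge_atTop 0] with T hT
    calc ∫ t in (0 : ℝ)..T, gain R C β α q t
        ≤ ∫ t in (0 : ℝ)..T, Real.exp (-β * t) * hamiltonian A Q R C 0 := by
          refine intervalIntegral.integral_mono_on hT (intervalIntegrable_gain le_rfl hT hg)
            (Continuous.intervalIntegrable (by fun_prop) _ _) fun t ht => ?_
          simpa using M.gain_le h ht.1 0
      _ = _ := by
          rw [intervalIntegral.integral_mul_const, integral_exp_neg hβ.ne']
          simp

/-! ### The exponential costate and weak duality -/

theorem hasDerivAt_Psi (M : Model A Q R C β) (hζ : 0 < zeta A Q R C) {p : ℝ} (hp : 0 < p)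
    (hc : ContinuousAt (drift A Q R C) p) :
    HasDerivAt (Psi A Q R C β) (drift A Q R C p / (β * p)) p := by
  have hβ := M.beta_pos
  have hfun : Psi A Q R C β = fun p => -∫ z in p..(zeta A Q R C), drift A Q R C z / (β * z) :=
    funext M.Psi_eq
  have hmeas : Measurable fun z => drift A Q R C z / (β * z) :=
    M.drift_mono.measurable.div (by fun_prop)
  rw [hfun]
  have := (intervalIntegral.integral_hasDerivAt_left (M.intervalIntegrable_drift_div hp hζ)
    hmeas.stronglyMeasurable.stronglyMeasurableAtFilter
    (hc.div (by fun_prop) (by positivity))).neg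
  rwa [neg_neg] at this

theorem countable_costate (M : Model A Q R C β) {p₀ : ℝ} (hp : 0 < p₀) :
    {t | ¬ ContinuousAt (drift A Q R C) (p₀ * Real.exp (β * t))}.Countable := by
  refine M.countable_drift.preimage_of_injOn (f := fun t => p₀ * Real.exp (β * t))
    fun s _ t _ hst => ?_
  have h1 := mul_left_cancel₀ hp.ne' hst
  exact mul_left_cancel₀ M.beta_pos.ne' (Real.exp_injective h1)

theorem costate_mono (M : Model A Q R C β) {p₀ : ℝ} (hp : 0 < p₀) :
    Monotone fun t => p₀ * Real.exp (β * t) := fun s t hst => by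
  have := M.beta_pos
  dsimp only
  gcongr

theorem continuousOn_Psi_costate (M : Model A Q R C β) {p₀ T : ℝ} (hp : 0 < p₀)
    (hT : p₀ * Real.exp (β * T) ≤ zeta A Q R C) :
    ContinuousOn (fun t => Psi A Q R C β (p₀ * Real.exp (β * t))) (Icc 0 T) := by
  refine (M.Psi_continuousOn hp).comp (by fun_prop) fun t ht => ⟨?_, ?_⟩
  · simpa using M.costate_mono hp ht.1
  · exact (M.costate_mono hp ht.2).trans hT

/-- Along the exponential costate the net production integrates to the increment of `Psi`. -/
theorem integral_drift_costate (M : Model A Q R C β) (hζ : 0 < zeta A Q R C) {p₀ T : ℝ}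
    (hp : 0 < p₀) (hT0 : 0 ≤ T) (hT : p₀ * Real.exp (β * T) ≤ zeta A Q R C) :
    ∫ t in (0 : ℝ)..T, drift A Q R C (p₀ * Real.exp (β * t)) =
      Psi A Q R C β (p₀ * Real.exp (β * T)) - Psi A Q R C β p₀ := by
  have hβ := M.beta_pos
  rw [MeasureTheory.integral_eq_of_hasDerivAt_off_countable_of_le
    (fun t => Psi A Q R C β (p₀ * Real.exp (β * t))) _ hT0 (M.countable_costate hp)
    (M.continuousOn_Psi_costate hp hT) (fun t ht => ?_)
    (show IntervalIntegrable (fun t => drift A Q R C (p₀ * Real.exp (β * t))) volume 0 T from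
      (M.drift_mono.comp (M.costate_mono hp)).intervalIntegrable)]
  · simp
  · have := (M.hasDerivAt_Psi hζ (by positivity) (not_not.1 ht.2)).comp t
      (hasDerivAt_costate β p₀ t)
    exact this.congr_deriv (div_mul_cancel₀ _ (by positivity))

/-- The discounted Hamiltonian along the exponential costate. -/
theorem integral_hamiltonian_costate (M : Model A Q R C β) (hζ : 0 < zeta A Q R C) {p₀ T : ℝ}
    (hp : 0 < p₀) (hT0 : 0 ≤ T) (hT : p₀ * Real.exp (β * T) = zeta A Q R C) :
    ∫ t in (0 : ℝ)..T, Real.exp (-β * t) * hamiltonian A Q R C (p₀ * Real.exp (β * t)) =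
      hamiltonian A Q R C p₀ / β - Real.exp (-β * T) * hamiltonian A Q R C (zeta A Q R C) / β -
        p₀ * Psi A Q R C β p₀ := by
  have hβ := M.beta_pos
  have hH := M.continuous_hamiltonian
  rw [MeasureTheory.integral_eq_of_hasDerivAt_off_countable_of_le
    (fun t => -(Real.exp (-β * t) * hamiltonian A Q R C (p₀ * Real.exp (β * t))) / β +
      p₀ * Psi A Q R C β (p₀ * Real.exp (β * t))) _ hT0 (M.countable_costate hp)
    (ContinuousOn.add (Continuous.continuousOn (by fun_prop))
      ((M.continuousOn_Psi_costate hp hT.le).const_mul p₀)) (fun t ht => ?_)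
    (Continuous.intervalIntegrable (by fun_prop) _ _)]
  · simp only [hT, Psi_zeta]
    simp
    ring
  · have hc := hasDerivAt_costate β p₀ t
    have h1 := (M.hasDerivAt_Psi hζ (by positivity) (not_not.1 ht.2)).comp t hc
    have h2 := (M.hasDerivAt_hamiltonian (not_not.1 ht.2)).comp t hc
    have h3 : HasDerivAt (fun t => Real.exp (-β * t)) (Real.exp (-β * t) * (-β * 1)) t :=
      ((hasDerivAt_id t).const_mul (-β)).exp
    refine (((h3.mul h2).neg.div_const β).add (h1.const_mul p₀)).congr_deriv ?_
    have h5 : Real.exp (-β * t) = (Real.exp (β * t))⁻¹ := by rw [← Real.exp_neg]; ring_nf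
    have h6 := (Real.exp_pos (β * t)).ne'
    simp only [Function.comp, h5]
    field_simp
    ring

/-- The time at which the exponential costate started at `p₀` reaches `zeta`. -/
theorem exists_time (M : Model A Q R C β) {p₀ : ℝ} (hp : p₀ ∈ Ioc 0 (zeta A Q R C)) :
    ∃ T, 0 ≤ T ∧ p₀ * Real.exp (β * T) = zeta A Q R C := by
  have hβ := M.beta_pos
  have hζ := hp.1.trans_le hp.2
  have hp0 := hp.1
  refine ⟨Real.log (zeta A Q R C / p₀) / β, div_nonneg (Real.log_nonneg ?_) hβ.le, ?_⟩
  · rw [le_div_iff₀ hp0]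
    linarith [hp.2]
  · rw [mul_div_cancel₀ _ hβ.ne', Real.exp_log (by positivity)]
    field_simp

/-- Weak duality: each initial costate bounds the profit.  The bound comes from the costate that
grows exponentially until it reaches `zeta` and stays there; the discounted costate is
non-increasing, so the non-negative inventory can be dropped after integrating by parts. -/
theorem profit_le (M : Model A Q R C β) (h : Admissible A Q x α q) {p₀ : ℝ}
    (hp : p₀ ∈ Ioc 0 (zeta A Q R C)) :
    profit R C β α q ≤
      ((hamiltonian A Q R C p₀ / β + p₀ * (x - Psi A Q R C β p₀) : ℝ) : EReal) := by
  have hβ := M.beta_pos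
  have hH := M.continuous_hamiltonian
  have hζ := hp.1.trans_le hp.2
  obtain ⟨S, hS0, hS⟩ := M.exists_time hp
  have hflow := fun t ht => M.intervalIntegrable_flow h (t := t) ht
  have hexpS : Real.exp (-β * S) * zeta A Q R C = p₀ := by
    rw [← hS, mul_left_comm, ← Real.exp_add]
    simp
  refine M.profit_le_of_eventually_le h (b := fun T => hamiltonian A Q R C p₀ / β +
    p₀ * (x - Psi A Q R C β p₀) -
      Real.exp (-β * T) * (hamiltonian A Q R C (zeta A Q R C) / β)) ?_ fun hg => ?_
  · simpa using ((tendsto_exp_neg hβ).mul_const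
      (hamiltonian A Q R C (zeta A Q R C) / β)).const_sub
        (hamiltonian A Q R C p₀ / β + p₀ * (x - Psi A Q R C β p₀))
  filter_upwards [eventually_ge_atTop S] with T hT
  have hT0 := hS0.trans hT
  -- up to time `S` the discounted costate is the constant `p₀`
  have h1 : ∫ t in (0 : ℝ)..S, gain R C β α q t ≤
      ∫ t in (0 : ℝ)..S, (Real.exp (-β * t) * hamiltonian A Q R C (p₀ * Real.exp (β * t)) -
        p₀ * (α t - q t)) := by
    refine intervalIntegral.integral_mono_on hS0 (intervalIntegrable_gain le_rfl hS0 hg)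
      ((Continuous.intervalIntegrable (by fun_prop) _ _).sub ((hflow S hS0).const_mul p₀))
      fun t ht => ?_
    refine (M.gain_le h ht.1 (p₀ * Real.exp (β * t))).trans_eq ?_
    have : Real.exp (-β * t) * Real.exp (β * t) = 1 := by
      rw [← Real.exp_add]
      simp
    linear_combination (-p₀ * (α t - q t)) * this
  rw [intervalIntegral.integral_sub (Continuous.intervalIntegrable (by fun_prop) _ _)
    ((hflow S hS0).const_mul p₀), intervalIntegral.integral_const_mul,
    M.integral_hamiltonian_costate hζ hp.1 hS0 hS] at h1
  have hflowST : IntervalIntegrable (fun t => Real.exp (-β * t) * (α t - q t)) volume S T :=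
    ((hflow S hS0).symm.trans (hflow T hT0)).continuousOn_mul (by fun_prop)
  -- from time `S` on the costate is the constant `ζ`
  have h2 : ∫ t in S..T, gain R C β α q t ≤
      ∫ t in S..T, (Real.exp (-β * t) * hamiltonian A Q R C (zeta A Q R C) -
        zeta A Q R C * (Real.exp (-β * t) * (α t - q t))) := by
    refine intervalIntegral.integral_mono_on hT (intervalIntegrable_gain hS0 hT0 hg)
      ((Continuous.intervalIntegrable (by fun_prop) _ _).sub (hflowST.const_mul _))
      fun t ht => ?_
    refine (M.gain_le h (hS0.trans ht.1) (zeta A Q R C)).trans_eq ?_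
    ring
  rw [intervalIntegral.integral_sub (Continuous.intervalIntegrable (by fun_prop) _ _)
    (hflowST.const_mul _), intervalIntegral.integral_const_mul,
    intervalIntegral.integral_mul_const, integral_exp_neg hβ.ne',
    integral_exp_mul_flow (x := x) hS0 hT (hflow T hT0)] at h2
  have h3 : 0 ≤ ∫ t in S..T, Real.exp (-β * t) * inventory x α q t :=
    intervalIntegral.integral_nonneg hT fun t ht =>
      mul_nonneg (Real.exp_pos _).le (h.inventory_nonneg t (hS0.trans ht.1))
  have h4 := mul_nonneg (Real.exp_pos (-β * T)).le (h.inventory_nonneg T hT0)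
  have h5 : ∫ t in (0 : ℝ)..S, (α t - q t) = inventory x α q S - x := by
    rw [inventory]
    ring
  rw [← intervalIntegral.integral_add_adjacent_intervals (intervalIntegrable_gain le_rfl hS0 hg)
    (intervalIntegrable_gain hS0 hT0 hg)]
  rw [h5] at h1
  have h6 := mul_nonneg hζ.le (add_nonneg h4 (mul_nonneg hβ.le h3))
  have h7 : zeta A Q R C * (Real.exp (-β * S) * inventory x α q S) = p₀ * inventory x α q S := by
    rw [← hexpS]
    ring
  have h8 : (Real.exp (-β * S) - Real.exp (-β * T)) / β * hamiltonian A Q R C (zeta A Q R C) =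
      Real.exp (-β * S) * hamiltonian A Q R C (zeta A Q R C) / β -
        Real.exp (-β * T) * (hamiltonian A Q R C (zeta A Q R C) / β) := by ring
  rw [h8] at h2
  linarith

end Model
end Firm

/-! ### Strategies that attain the dual bound -/

namespace Firm

/-- The `d`-periodic control that takes the value `u` during the fraction `θ` of each period and
`v` during the rest. -/
noncomputable def chatter (d θ u v t : ℝ) : ℝ :=
  if Int.fract (t / d) < θ then u else v

theorem chatter_eq_or (d θ u v u' v' t : ℝ) :
    (chatter d θ u v t = u ∧ chatter d θ u' v' t = u') ∨
      (chatter d θ u v t = v ∧ chatter d θ u' v' t = v') := by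
  unfold chatter
  split_ifs <;> simp

theorem measurable_chatter (d θ u v : ℝ) : Measurable (chatter d θ u v) :=
  Measurable.ite (measurableSet_lt (by fun_prop) measurable_const) measurable_const
    measurable_const

theorem chatter_sub (d θ u v u' v' t : ℝ) :
    chatter d θ u v t - chatter d θ u' v' t = chatter d θ (u - u') (v - v') t := by
  unfold chatter
  split_ifs <;> rfl

theorem intervalIntegrable_chatter (d θ u v a b : ℝ) :
    IntervalIntegrable (chatter d θ u v) volume a b := by
  rw [intervalIntegrable_iff]
  refine Measure.integrableOn_of_bounded (M := max |u| |v|) (by simp [uIoc])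
    (measurable_chatter d θ u v).aestronglyMeasurable (Eventually.of_forall fun t => ?_)
  rcases chatter_eq_or d θ u v u v t with h | h <;> simp [h.1]

theorem chatter_periodic {d : ℝ} (hd : d ≠ 0) (θ u v : ℝ) :
    Function.Periodic (chatter d θ u v) d := fun t => by
  simp [chatter, add_div, hd]

theorem chatter_of_lt {d θ u v t : ℝ} (hd : 0 < d) (hθ : θ ≤ 1) (h0 : 0 ≤ t) (ht : t < θ * d) :
    chatter d θ u v t = u := by
  have h1 : t / d < θ := (div_lt_iff₀ hd).2 ht
  rw [chatter, Int.fract_eq_self.2 ⟨div_nonneg h0 hd.le, h1.trans_le hθ⟩, if_pos h1]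

theorem chatter_of_ge {d θ u v t : ℝ} (hd : 0 < d) (hθ : 0 ≤ θ) (ht : θ * d ≤ t) (ht1 : t < d) :
    chatter d θ u v t = v := by
  have h1 : θ ≤ t / d := (le_div_iff₀ hd).2 ht
  rw [chatter, Int.fract_eq_self.2 ⟨hθ.trans h1, (div_lt_one hd).2 ht1⟩, if_neg h1.not_gt]

/-- A balanced chattering flow stays between `0` and its gain over one period. -/
theorem integral_chatter_mem {d θ u v : ℝ} (hd : 0 < d) (hθ0 : 0 ≤ θ) (hθ1 : θ ≤ 1) (hu : 0 ≤ u)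
    (hv : v ≤ 0) (hbal : θ * u + (1 - θ) * v = 0) (t : ℝ) :
    ∫ s in (0 : ℝ)..t, chatter d θ u v s ∈ Icc 0 (u * d) := by
  have hI := intervalIntegrable_chatter d θ u v
  have hθd : θ * d ≤ d := by nlinarith
  have hθd0 : 0 ≤ θ * d := by positivity
  have h1 : ∫ s in (0 : ℝ)..(θ * d), chatter d θ u v s = θ * d * u := by
    rw [intervalIntegral.integral_congr_Ioo_of_le hθd0 (g := fun _ => u)
      fun s hs => chatter_of_lt hd hθ1 hs.1.le hs.2]
    simp
  have h2 : ∫ s in (θ * d)..d, chatter d θ u v s = (d - θ * d) * v := by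
    rw [intervalIntegral.integral_congr_Ioo_of_le hθd (g := fun _ => v)
      fun s hs => chatter_of_ge hd hθ0 hs.1.le hs.2]
    simp
  have htot : ∫ s in (0 : ℝ)..d, chatter d θ u v s = 0 := by
    rw [← intervalIntegral.integral_add_adjacent_intervals (hI 0 (θ * d)) (hI _ _), h1, h2]
    linear_combination d * hbal
  have hne : ((fun t => ∫ s in (0 : ℝ)..t, chatter d θ u v s) '' Icc 0 d).Nonempty :=
    ⟨_, 0, ⟨le_rfl, hd.le⟩, rfl⟩
  constructor
  · have h := (chatter_periodic hd.ne' θ u v).sInf_add_zsmul_le_integral_of_pos (hI 0 d) hd t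
    rw [htot, smul_zero, add_zero] at h
    refine le_trans (le_csInf hne ?_) h
    rintro _ ⟨s, hs, rfl⟩
    rcases le_total s (θ * d) with hsθ | hsθ
    · dsimp only
      rw [intervalIntegral.integral_congr_Ioo_of_le hs.1 (g := fun _ => u)
        fun r hr => chatter_of_lt hd hθ1 hr.1.le (hr.2.trans_le hsθ)]
      simpa using mul_nonneg hs.1 hu
    · have h3 := intervalIntegral.integral_add_adjacent_intervals (hI 0 s) (hI s d)
      rw [htot, intervalIntegral.integral_congr_Ioo_of_le hs.2 (g := fun _ => v)
        fun r hr => chatter_of_ge hd hθ0 (hsθ.trans hr.1.le) hr.2] at h3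
      simp only [intervalIntegral.integral_const, smul_eq_mul] at h3
      dsimp only
      nlinarith [hs.2]
  · have h := (chatter_periodic hd.ne' θ u v).integral_le_sSup_add_zsmul_of_pos (hI 0 d) hd t
    rw [htot, smul_zero, add_zero] at h
    refine h.trans (csSup_le hne ?_)
    rintro _ ⟨s, hs, rfl⟩
    have h3 : ∫ r in (0 : ℝ)..s, chatter d θ u v r ≤ ∫ r in (0 : ℝ)..s, u := by
      refine intervalIntegral.integral_mono_on hs.1 (hI _ _) (by simp) fun r _ => ?_
      rcases chatter_eq_or d θ u v u v r with h | h <;> rw [h.1]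
      exact hv.trans hu
    simp only [intervalIntegral.integral_const, smul_eq_mul, sub_zero] at h3
    nlinarith [hs.2]

theorem intervalIntegrable_of_mem_Icc {g : ℝ → ℝ} {K : ℝ} (hg : Measurable g)
    (hK : ∀ t, g t ∈ Icc 0 K) (a b : ℝ) : IntervalIntegrable g volume a b := by
  rw [intervalIntegrable_iff]
  refine Measure.integrableOn_of_bounded (M := K) (by simp [uIoc]) hg.aestronglyMeasurable
    (Eventually.of_forall fun t => ?_)
  rw [Real.norm_eq_abs, abs_of_nonneg (hK t).1]
  exact (hK t).2

theorem le_extValue_of_forall {A Q : Set ℝ} {R C : ℝ → ℝ} {β x w c : ℝ} (hc : 0 < c)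
    (h : ∀ ε > 0, ∃ α q, Admissible A Q x α q ∧ ((w - c * ε : ℝ) : EReal) ≤ profit R C β α q) :
    (w : EReal) ≤ extValue A Q R C β x := by
  refine le_of_forall_lt fun y hy => ?_
  obtain ⟨r, hyr, hrw⟩ := EReal.lt_iff_exists_real_btwn.1 hy
  rw [EReal.coe_lt_coe_iff] at hrw
  obtain ⟨α, q, hadm, hle⟩ := h ((w - r) / c) (div_pos (by linarith) hc)
  rw [mul_div_cancel₀ _ hc.ne', sub_sub_cancel] at hle
  exact hyr.trans_le (hle.trans (le_iSup₂_of_le α q (le_iSup_of_le hadm le_rfl)))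

namespace Model

variable {A Q : Set ℝ} {R C : ℝ → ℝ} {β : ℝ} {x : ℝ}

/-- Controls that keep the inventory within `ε` of its initial level, with a profit rate that
exceeds `H(ζ) - ζ X'` up to `ε`.  Since `R` and `C` are not assumed concave and convex, the
stationary point has to be approximated by chattering between maximisers at costates slightly below
and slightly above `ζ`. -/
theorem exists_holding (M : Model A Q R C β) {ε : ℝ} (hε : 0 < ε) :
    ∃ α q : ℝ → ℝ, Measurable α ∧ Measurable q ∧ (∀ t, α t ∈ A) ∧ (∀ t, q t ∈ Q) ∧
      (∃ K, ∀ t, α t ≤ K ∧ C (α t) ≤ K) ∧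
      (∀ t, ∫ s in (0 : ℝ)..t, (α s - q s) ∈ Icc 0 ε) ∧
      ∀ t, hamiltonian A Q R C (zeta A Q R C) - zeta A Q R C * (α t - q t) - ε ≤
        R (q t) - C (α t) := by
  set ζ := zeta A Q R C
  set K := drift A Q R C (ζ + 1) - drift A Q R C (ζ - 1)
  have hl : drift A Q R C (ζ - 1) < 0 := M.drift_neg (sub_one_lt ζ)
  have hr : 0 ≤ drift A Q R C (ζ + 1) := M.drift_nonneg (lt_add_one ζ)
  have hK : 0 < K := by linarith
  -- `K` bounds the net production of both maximisers, and replacing `ζ ± η` by `ζ` costs `η * K`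
  set η := min 1 (ε / K)
  have hη : 0 < η := lt_min one_pos (by positivity)
  have hη1 : η ≤ 1 := min_le_left _ _
  have hηK : η * K ≤ ε := (le_div_iff₀ hK).1 (min_le_right _ _)
  set v := drift A Q R C (ζ - η) with hv
  set u := drift A Q R C (ζ + η) with hu
  have hv0 : v < 0 := M.drift_neg (sub_lt_self ζ hη)
  have hu0 : 0 ≤ u := M.drift_nonneg (lt_add_of_pos_right ζ hη)
  have hvl : drift A Q R C (ζ - 1) ≤ v := M.drift_mono (by linarith)
  have hur : u ≤ drift A Q R C (ζ + 1) := M.drift_mono (by linarith)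
  -- the fraction of time that makes the mean net production vanish; `v` is strictly negative, as
  -- `ζ` is the least minimum point
  set θ := -v / (u - v)
  have huv : 0 < u - v := by linarith
  have hθ0 : 0 ≤ θ := div_nonneg (by linarith) huv.le
  have hθ1 : θ ≤ 1 := (div_le_one huv).2 (by linarith)
  have hbal : θ * u + (1 - θ) * v = 0 := by
    have : θ * (u - v) = -v := div_mul_cancel₀ _ huv.ne'
    linarith
  set d := ε / (u + 1)
  have hd : 0 < d := by positivity
  have hud : u * d ≤ ε := by
    have : d * (u + 1) = ε := div_mul_cancel₀ _ (by positivity)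
    linarith
  set α := chatter d θ (optProd A C (ζ + η)) (optProd A C (ζ - η)) with hα
  set q := chatter d θ (optSales Q R (ζ + η)) (optSales Q R (ζ - η)) with hq
  have hcases : ∀ t, (α t = optProd A C (ζ + η) ∧ q t = optSales Q R (ζ + η)) ∨
      (α t = optProd A C (ζ - η) ∧ q t = optSales Q R (ζ - η)) :=
    fun t => chatter_eq_or _ _ _ _ _ _ t
  refine ⟨α, q, measurable_chatter _ _ _ _, measurable_chatter _ _ _ _, fun t => ?_, fun t => ?_,
    ⟨max (optProd A C (ζ + η)) (max (C (optProd A C (ζ + η))) (C (optProd A C (ζ - η)))),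
      fun t => ?_⟩, fun t => ?_, fun t => ?_⟩
  · rcases hcases t with h | h <;> rw [h.1] <;> exact (M.optProd_spec _).1
  · rcases hcases t with h | h <;> rw [h.2] <;> exact (M.optSales_spec _).1
  · have hmono : optProd A C (ζ - η) ≤ optProd A C (ζ + η) := M.optProd_mono (by linarith)
    rcases hcases t with h | h <;> rw [h.1]
    · exact ⟨le_max_left _ _, (le_max_left _ _).trans (le_max_right _ _)⟩
    · exact ⟨hmono.trans (le_max_left _ _), (le_max_right _ _).trans (le_max_right _ _)⟩
  · have h := integral_chatter_mem hd hθ0 hθ1 hu0 hv0.le hbal t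
    simp only [hα, hq, chatter_sub]
    exact ⟨h.1, h.2.trans hud⟩
  · rcases hcases t with h | h <;> rw [h.1, h.2]
    · have h1 := M.hamiltonian_zeta_le (ζ + η)
      rw [M.hamiltonian_eq (ζ + η), ← hu] at h1
      have h2 : optProd A C (ζ + η) - optSales Q R (ζ + η) = u := rfl
      rw [h2]
      have : η * u ≤ η * K := by gcongr; linarith
      linarith
    · have h1 := M.hamiltonian_zeta_le (ζ - η)
      rw [M.hamiltonian_eq (ζ - η), ← hv] at h1
      have h2 : optProd A C (ζ - η) - optSales Q R (ζ - η) = v := rfl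
      rw [h2]
      have : η * (-v) ≤ η * K := by gcongr; linarith
      linarith

theorem extValue_eq_of_zeta_eq_zero (M : Model A Q R C β) (hζ : zeta A Q R C = 0) (hx : 0 ≤ x) :
    extValue A Q R C β x = ((hamiltonian A Q R C 0 / β : ℝ) : EReal) := by
  have hβ := M.beta_pos
  refine le_antisymm (iSup₂_le fun α q => iSup_le fun h => M.profit_le_hamiltonian_zero h)
    (le_extValue_of_forall (inv_pos.2 hβ) fun ε hε => ?_)
  obtain ⟨α, q, hαm, hqm, hα, hq, ⟨K, hK⟩, hX, hgain⟩ := M.exists_holding hε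
  have hadm : Admissible A Q x α q :=
    ⟨hαm, hqm, fun t _ => hα t, fun t _ => hq t, fun t _ =>
      intervalIntegrable_of_mem_Icc hαm (fun t => ⟨M.prod_nonneg (hα t), (hK t).1⟩) 0 t,
      fun t _ => add_nonneg hx (hX t).1⟩
  refine ⟨α, q, hadm, M.le_profit_of_eventually_le hadm (fun t _ => (hK t).2)
    (b := fun T => (1 - Real.exp (-β * T)) / β * (hamiltonian A Q R C 0 - ε)) ?_ fun hg => ?_⟩
  · have := (((tendsto_exp_neg hβ).const_sub 1).div_const β).mul_const
      (hamiltonian A Q R C 0 - ε)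
    convert this using 2
    ring
  · filter_upwards [eventually_ge_atTop 0] with T hT
    calc _ = ∫ t in (0 : ℝ)..T, Real.exp (-β * t) * (hamiltonian A Q R C 0 - ε) := by
          rw [intervalIntegral.integral_mul_const, integral_exp_neg hβ.ne']
          simp
      _ ≤ ∫ t in (0 : ℝ)..T, gain R C β α q t := by
          refine intervalIntegral.integral_mono_on hT
            (Continuous.intervalIntegrable (by fun_prop) _ _)
            (intervalIntegrable_gain le_rfl hT hg) fun t ht => ?_
          have := hgain t
          rw [hζ, zero_mul, sub_zero] at this
          exact mul_le_mul_of_nonneg_left this (Real.exp_pos _).le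

/-- The primal strategy that matches the dual bound at the costate `xi x`: the maximisers along the
exponential costate empty the inventory exactly when the costate reaches `zeta`; from then on the
inventory is held near `0`. -/
theorem exists_strategy (M : Model A Q R C β) (hζ : 0 < zeta A Q R C) (hx : 0 ≤ x) {ε : ℝ}
    (hε : 0 < ε) :
    ∃ α q, Admissible A Q x α q ∧
      ((hamiltonian A Q R C (xi A Q R C β x) / β - (β⁻¹ + zeta A Q R C) * ε : ℝ) : EReal) ≤
        profit R C β α q := by
  have hβ := M.beta_pos
  have hH := M.continuous_hamiltonian
  obtain ⟨α', q', hαm, hqm, hα, hq, ⟨K, hK⟩, hX, hgain⟩ := M.exists_holding hε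
  set ζ := zeta A Q R C with hζdef
  set p₀ := xi A Q R C β x
  have hp : p₀ ∈ Ioc 0 ζ := M.xi_mem hζ hx
  have hΨ : Psi A Q R C β p₀ = x := M.Psi_xi hζ hx
  obtain ⟨S, hS0, hS⟩ := M.exists_time hp
  have hpS : ∀ {t}, t ≤ S → p₀ * Real.exp (β * t) ≤ ζ := fun ht =>
    (M.costate_mono hp.1 ht).trans_eq hS
  have hexpS : Real.exp (-β * S) * ζ = p₀ := by
    rw [hζdef, ← hS, mul_left_comm, ← Real.exp_add]
    simp
  set α : ℝ → ℝ := fun t => if t < S then optProd A C (p₀ * Real.exp (β * t)) else α' (t - S)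
  set q : ℝ → ℝ := fun t => if t < S then optSales Q R (p₀ * Real.exp (β * t)) else q' (t - S)
  have hαlt : ∀ {t}, t < S → α t = optProd A C (p₀ * Real.exp (β * t)) := fun h => if_pos h
  have hqlt : ∀ {t}, t < S → q t = optSales Q R (p₀ * Real.exp (β * t)) := fun h => if_pos h
  have hαge : ∀ {t}, S ≤ t → α t = α' (t - S) := fun h => if_neg h.not_gt
  have hqge : ∀ {t}, S ≤ t → q t = q' (t - S) := fun h => if_neg h.not_gt
  have hαA : ∀ t, α t ∈ A := fun t => by
    rcases lt_or_ge t S with h | h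
    · rw [hαlt h]
      exact (M.optProd_spec _).1
    · rw [hαge h]
      exact hα _
  have hqQ : ∀ t, q t ∈ Q := fun t => by
    rcases lt_or_ge t S with h | h
    · rw [hqlt h]
      exact (M.optSales_spec _).1
    · rw [hqge h]
      exact hq _
  have hαmeas : Measurable α :=
    Measurable.ite measurableSet_Iio (M.optProd_mono.measurable.comp (by fun_prop))
      (hαm.comp (by fun_prop))
  have hqmeas : Measurable q :=
    Measurable.ite measurableSet_Iio (M.optSales_anti.measurable.comp (by fun_prop))
      (hqm.comp (by fun_prop))
  have hαint : ∀ a b, IntervalIntegrable α volume a b :=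
    intervalIntegrable_of_mem_Icc (K := max (optProd A C ζ) K) hαmeas fun t => by
      refine ⟨M.prod_nonneg (hαA t), ?_⟩
      rcases lt_or_ge t S with h | h
      · rw [hαlt h]
        exact (M.optProd_mono (hpS h.le)).trans (le_max_left _ _)
      · rw [hαge h]
        exact (hK _).1.trans (le_max_right _ _)
  have hf : ∀ a b, IntervalIntegrable (fun s => α s - q s) volume a b := fun a b => by
    obtain ⟨L, hL⟩ := M.sales_compact.bddAbove
    exact (hαint a b).sub (intervalIntegrable_of_mem_Icc hqmeas
      (fun t => ⟨M.sales_nonneg (hqQ t), hL (hqQ t)⟩) a b)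
  -- until time `S` the inventory is `Psi` of the costate
  have hX1 : ∀ t, 0 ≤ t → t ≤ S → inventory x α q t = Psi A Q R C β (p₀ * Real.exp (β * t)) := by
    intro t ht0 ht
    have h := M.integral_drift_costate hζ hp.1 ht0 (hpS ht)
    rw [inventory, intervalIntegral.integral_congr_Ioo_of_le ht0
      (g := fun s => drift A Q R C (p₀ * Real.exp (β * s))) fun s hs => ?_, h, hΨ]
    · ring
    · simp only [hαlt (hs.2.trans_le ht), hqlt (hs.2.trans_le ht), drift]
  have hXS : inventory x α q S = 0 := by rw [hX1 S hS0 le_rfl, hS, Psi_zeta]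
  have hX2 : ∀ t, S ≤ t → inventory x α q t ∈ Icc 0 ε := by
    intro t ht
    rw [inventory_eq_add (hf 0 S) (hf 0 t), hXS, zero_add,
      intervalIntegral.integral_congr (g := fun s => α' (s - S) - q' (s - S)) fun s hs => ?_,
      intervalIntegral.integral_comp_sub_right (fun s => α' s - q' s), sub_self]
    · exact hX _
    · rw [uIcc_of_le ht] at hs
      simp only [hαge hs.1, hqge hs.1]
  have hadm : Admissible A Q x α q := by
    refine ⟨hαmeas, hqmeas, fun t _ => hαA t, fun t _ => hqQ t, fun t _ => hαint 0 t,
      fun t ht => ?_⟩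
    rcases le_total t S with h | h
    · rw [hX1 t ht h]
      exact (M.Psi_bijOn hζ).mapsTo ⟨mul_pos hp.1 (Real.exp_pos _), hpS h⟩
    · exact (hX2 t h).1
  have hCK : ∀ t, 0 ≤ t → C (α t) ≤ max (C (optProd A C ζ)) K := fun t _ => by
    rcases lt_or_ge t S with h | h
    · rw [hαlt h]
      exact (M.cost_mono (M.optProd_spec _).1 (M.optProd_spec _).1
        (M.optProd_mono (hpS h.le))).trans (le_max_left _ _)
    · rw [hαge h]
      exact (hK _).2.trans (le_max_right _ _)
  refine ⟨α, q, hadm, M.le_profit_of_eventually_le hadm hCK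
    (b := fun T => hamiltonian A Q R C p₀ / β - (β⁻¹ + ζ) * ε -
      Real.exp (-β * T) * (hamiltonian A Q R C ζ / β)) ?_ fun hg => ?_⟩
  · simpa using ((tendsto_exp_neg hβ).mul_const (hamiltonian A Q R C ζ / β)).const_sub
      (hamiltonian A Q R C p₀ / β - (β⁻¹ + ζ) * ε)
  filter_upwards [eventually_ge_atTop S] with T hT
  have hT0 := hS0.trans hT
  have h1 : ∫ t in (0 : ℝ)..S, gain R C β α q t =
      hamiltonian A Q R C p₀ / β - Real.exp (-β * S) * hamiltonian A Q R C ζ / β := by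
    have heq : ∀ t ∈ Ioo 0 S, gain R C β α q t =
        Real.exp (-β * t) * hamiltonian A Q R C (p₀ * Real.exp (β * t)) -
          p₀ * (α t - q t) := fun t ht => by
      have he : Real.exp (-β * t) * Real.exp (β * t) = 1 := by
        rw [← Real.exp_add]
        simp
      rw [gain, hαlt ht.2, hqlt ht.2, M.hamiltonian_eq, drift]
      linear_combination (-p₀ * (optProd A C (p₀ * Real.exp (β * t)) -
        optSales Q R (p₀ * Real.exp (β * t)))) * he
    rw [intervalIntegral.integral_congr_Ioo_of_le hS0 heq,
      intervalIntegral.integral_sub (Continuous.intervalIntegrable (by fun_prop) _ _)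
      ((hf 0 S).const_mul p₀), intervalIntegral.integral_const_mul,
      M.integral_hamiltonian_costate hζ hp.1 hS0 hS, hΨ]
    have h5 : x + ∫ t in (0 : ℝ)..S, (α t - q t) = 0 := hXS
    linear_combination (-p₀) * h5
  have hfe : IntervalIntegrable (fun t => Real.exp (-β * t) * (α t - q t)) volume S T :=
    (hf S T).continuousOn_mul (by fun_prop)
  have h2 : ∫ t in S..T, (Real.exp (-β * t) * (hamiltonian A Q R C ζ - ε) -
      ζ * (Real.exp (-β * t) * (α t - q t))) ≤ ∫ t in S..T, gain R C β α q t := by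
    refine intervalIntegral.integral_mono_on hT
      ((Continuous.intervalIntegrable (by fun_prop) _ _).sub (hfe.const_mul _))
      (intervalIntegrable_gain hS0 hT0 hg) fun t ht => ?_
    have := mul_le_mul_of_nonneg_left (hgain (t - S)) (Real.exp_pos (-β * t)).le
    rw [gain, hαge ht.1, hqge ht.1]
    linarith
  rw [intervalIntegral.integral_sub (Continuous.intervalIntegrable (by fun_prop) _ _)
    (hfe.const_mul _), intervalIntegral.integral_const_mul,
    intervalIntegral.integral_mul_const, integral_exp_neg hβ.ne',
    integral_exp_mul_flow (x := x) hS0 hT (hf 0 T), hXS, mul_zero, sub_zero] at h2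
  have hXc : ContinuousOn (fun t => inventory x α q t) (uIcc S T) := by
    refine continuousOn_const.add ?_
    refine (intervalIntegral.continuousOn_primitive_interval' (hf 0 T) left_mem_uIcc).mono ?_
    rw [uIcc_of_le hT, uIcc_of_le hT0]
    exact Icc_subset_Icc_left hS0
  have h3 : ∫ t in S..T, Real.exp (-β * t) * inventory x α q t ≤
      ∫ t in S..T, Real.exp (-β * t) * ε := by
    refine intervalIntegral.integral_mono_on hT (ContinuousOn.intervalIntegrable
      (ContinuousOn.mul (by fun_prop) hXc)) (Continuous.intervalIntegrable (by fun_prop) _ _)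
      fun t ht => ?_
    exact mul_le_mul_of_nonneg_left (hX2 t ht.1).2 (Real.exp_pos _).le
  rw [intervalIntegral.integral_mul_const, integral_exp_neg hβ.ne'] at h3
  have h4 := mul_le_mul_of_nonneg_left (hX2 T hT).2 (Real.exp_pos (-β * T)).le
  have hES : Real.exp (-β * S) ≤ 1 := Real.exp_le_one_iff.2 (by nlinarith)
  have hET := Real.exp_pos (-β * T)
  have h5 : β * ∫ t in S..T, Real.exp (-β * t) * inventory x α q t ≤
      (Real.exp (-β * S) - Real.exp (-β * T)) * ε := by
    refine (mul_le_mul_of_nonneg_left h3 hβ.le).trans_eq ?_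
    field_simp
  have h6 : ζ * (Real.exp (-β * T) * inventory x α q T +
      β * ∫ t in S..T, Real.exp (-β * t) * inventory x α q t) ≤ ζ * ε := by
    refine mul_le_mul_of_nonneg_left ?_ hζ.le
    nlinarith
  have h7 : (Real.exp (-β * S) - Real.exp (-β * T)) / β * ε ≤ β⁻¹ * ε := by
    rw [div_eq_inv_mul]
    refine mul_le_mul_of_nonneg_right ?_ hε.le
    exact mul_le_of_le_one_right (inv_pos.2 hβ).le (by linarith)
  rw [← intervalIntegral.integral_add_adjacent_intervals (intervalIntegrable_gain le_rfl hS0 hg)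
    (intervalIntegrable_gain hS0 hT0 hg), h1]
  have h8 : (Real.exp (-β * S) - Real.exp (-β * T)) / β * (hamiltonian A Q R C ζ - ε) =
      Real.exp (-β * S) * hamiltonian A Q R C ζ / β -
        Real.exp (-β * T) * (hamiltonian A Q R C ζ / β) -
          (Real.exp (-β * S) - Real.exp (-β * T)) / β * ε := by ring
  rw [h8] at h2
  linarith

theorem extValue_eq (M : Model A Q R C β) (hζ : 0 < zeta A Q R C) (hx : 0 ≤ x) :
    extValue A Q R C β x = ((hamiltonian A Q R C (xi A Q R C β x) / β : ℝ) : EReal) := by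
  have hβ := M.beta_pos
  refine le_antisymm (iSup₂_le fun α q => iSup_le fun h => ?_)
    (le_extValue_of_forall (add_pos (inv_pos.2 hβ) hζ) fun ε hε => M.exists_strategy hζ hx hε)
  simpa [M.Psi_xi hζ hx] using M.profit_le h (M.xi_mem hζ hx)

end Model
end Firm

/-! ### The value function -/

namespace Firm
namespace Model

variable {A Q : Set ℝ} {R C : ℝ → ℝ} {β : ℝ} {x : ℝ}

theorem value_eq_of_zeta_eq_zero (M : Model A Q R C β) (hζ : zeta A Q R C = 0) (hx : 0 ≤ x) :
    value A Q R C β x = hamiltonian A Q R C 0 / β := by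
  rw [value, M.extValue_eq_of_zeta_eq_zero hζ hx, EReal.toReal_coe]

theorem value_eq (M : Model A Q R C β) (hζ : 0 < zeta A Q R C) (hx : 0 ≤ x) :
    value A Q R C β x = hamiltonian A Q R C (xi A Q R C β x) / β := by
  rw [value, M.extValue_eq hζ hx, EReal.toReal_coe]

theorem extValue_eq_coe_value (M : Model A Q R C β) (hx : 0 ≤ x) :
    extValue A Q R C β x = ((value A Q R C β x : ℝ) : EReal) := by
  rcases M.zeta_nonneg.eq_or_lt with hζ | hζ
  · rw [M.value_eq_of_zeta_eq_zero hζ.symm hx, M.extValue_eq_of_zeta_eq_zero hζ.symm hx]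
  · rw [M.value_eq hζ hx, M.extValue_eq hζ hx]

theorem value_le (M : Model A Q R C β) (hx : 0 ≤ x) :
    value A Q R C β x ≤ hamiltonian A Q R C 0 / β := by
  rw [← EReal.coe_le_coe_iff, ← M.extValue_eq_coe_value hx]
  exact iSup₂_le fun α q => iSup_le fun h => M.profit_le_hamiltonian_zero h

theorem le_value (M : Model A Q R C β) (hx : 0 ≤ x) :
    hamiltonian A Q R C (zeta A Q R C) / β ≤ value A Q R C β x := by
  have hβ := M.beta_pos
  rcases M.zeta_nonneg.eq_or_lt with hζ | hζ
  · rw [M.value_eq_of_zeta_eq_zero hζ.symm hx, ← hζ]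
  · rw [M.value_eq hζ hx]
    exact div_le_div_of_nonneg_right (M.hamiltonian_zeta_le _) hβ.le

theorem tendsto_value (M : Model A Q R C β) :
    Tendsto (value A Q R C β) atTop (𝓝 (hamiltonian A Q R C 0 / β)) := by
  rcases M.zeta_nonneg.eq_or_lt with hζ | hζ
  · refine tendsto_const_nhds.congr' ?_
    filter_upwards [eventually_ge_atTop 0] with x hx
    rw [M.value_eq_of_zeta_eq_zero hζ.symm hx]
  · refine (((M.continuous_hamiltonian.tendsto 0).comp (M.tendsto_xi hζ)).div_const β).congr' ?_
    filter_upwards [eventually_ge_atTop 0] with x hx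
    rw [M.value_eq hζ hx, Function.comp]

/-- The dual bound at the costate `xi x`, which is attained at `x`, makes `xi x` a supergradient of
the value function at `x`. -/
theorem value_le_supergradient (M : Model A Q R C β) (hζ : 0 < zeta A Q R C) {y : ℝ} (hx : 0 ≤ x)
    (hy : 0 ≤ y) :
    value A Q R C β y ≤ value A Q R C β x + xi A Q R C β x * (y - x) := by
  rw [← EReal.coe_le_coe_iff, ← M.extValue_eq_coe_value hy, M.value_eq hζ hx]
  refine iSup₂_le fun α q => iSup_le fun h => ?_
  simpa [M.Psi_xi hζ hx] using M.profit_le h (M.xi_mem hζ hx)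

theorem hasDerivWithinAt_value (M : Model A Q R C β) (hζ : 0 < zeta A Q R C) (hx : 0 ≤ x) :
    HasDerivWithinAt (value A Q R C β) (xi A Q R C β x) (Ici 0) x := by
  have h := hasDerivWithinAt_of_subgradient (f := fun y => -value A Q R C β y)
    (g := fun y => -xi A Q R C β y) (S := Ici 0) hx (fun z hz w hw => ?_)
    (M.xi_continuousOn hζ x hx).neg
  · simpa using h.fun_neg
  · have := M.value_le_supergradient hζ hz hw
    linarith

theorem valueDeriv_eq (M : Model A Q R C β) (hζ : 0 < zeta A Q R C) (hx : 0 ≤ x) :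
    valueDeriv A Q R C β x = xi A Q R C β x :=
  (M.hasDerivWithinAt_value hζ hx).derivWithin (uniqueDiffOn_Ici 0 x hx)

theorem hasDerivAt_value (M : Model A Q R C β) (hζ : 0 < zeta A Q R C) (hx : 0 < x) :
    HasDerivAt (value A Q R C β) (xi A Q R C β x) x :=
  (M.hasDerivWithinAt_value hζ hx.le).hasDerivAt (Ici_mem_nhds hx)

theorem continuousOn_value (M : Model A Q R C β) (hζ : 0 < zeta A Q R C) :
    ContinuousOn (value A Q R C β) (Ici 0) := fun _ hx =>
  (M.hasDerivWithinAt_value hζ hx).continuousWithinAt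

theorem contDiffOn_value (M : Model A Q R C β) (hζ : 0 < zeta A Q R C) :
    ContDiffOn ℝ 1 (value A Q R C β) (Ici 0) := by
  rw [contDiffOn_one_iff_derivWithin (uniqueDiffOn_Ici 0)]
  exact ⟨fun x hx => (M.hasDerivWithinAt_value hζ hx).differentiableWithinAt,
    (M.xi_continuousOn hζ).congr fun x hx => M.valueDeriv_eq hζ hx⟩

theorem intervalIntegrable_xi (M : Model A Q R C β) (hζ : 0 < zeta A Q R C) (hx : 0 ≤ x) :
    IntervalIntegrable (xi A Q R C β) volume 0 x := by
  refine ((M.xi_continuousOn hζ).mono ?_).intervalIntegrable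
  rw [uIcc_of_le hx]
  exact Icc_subset_Ici_self

theorem value_eq_integral (M : Model A Q R C β) (hζ : 0 < zeta A Q R C) (hx : 0 ≤ x) :
    value A Q R C β x =
      hamiltonian A Q R C (zeta A Q R C) / β + ∫ y in (0 : ℝ)..x, xi A Q R C β y := by
  rw [intervalIntegral.integral_eq_sub_of_hasDerivAt_of_le hx
    ((M.continuousOn_value hζ).mono Icc_subset_Ici_self)
    (fun y hy => M.hasDerivAt_value hζ hy.1) (M.intervalIntegrable_xi hζ hx),
    M.value_eq hζ le_rfl, M.xi_zero hζ]
  ring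

theorem strictMonoOn_value (M : Model A Q R C β) (hζ : 0 < zeta A Q R C) :
    StrictMonoOn (value A Q R C β) (Ici 0) := by
  intro x hx y hy hxy
  have h1 := M.value_le_supergradient hζ hy hx
  have h2 := mul_pos (M.xi_mem hζ hy).1 (sub_pos.2 hxy)
  linarith

theorem strictConcaveOn_value (M : Model A Q R C β) (hζ : 0 < zeta A Q R C) :
    StrictConcaveOn ℝ (Ici 0) (value A Q R C β) := by
  refine StrictAntiOn.strictConcaveOn_of_deriv (convex_Ici 0) (M.continuousOn_value hζ) ?_
  rw [interior_Ici]
  intro x hx y hy hxy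
  rw [(M.hasDerivAt_value hζ hx).deriv, (M.hasDerivAt_value hζ hy).deriv]
  exact M.xi_strictAntiOn hζ (Ioi_subset_Ici_self hx) (Ioi_subset_Ici_self hy) hxy

theorem absContOn_valueDeriv (M : Model A Q R C β) (hζ : 0 < zeta A Q R C) :
    AbsContOn (valueDeriv A Q R C β) (Ici 0) := by
  intro ε hε
  obtain ⟨δ, hδ, h⟩ := M.absContOn_xi hζ ε hε
  refine ⟨δ, hδ, fun k a b hab hdisj hsum => ?_⟩
  have heq : ∀ i, |valueDeriv A Q R C β (b i) - valueDeriv A Q R C β (a i)| =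
      |xi A Q R C β (b i) - xi A Q R C β (a i)| := fun i => by
    rw [M.valueDeriv_eq hζ ((hab i).2 (right_mem_Icc.2 (hab i).1.le)),
      M.valueDeriv_eq hζ ((hab i).2 (left_mem_Icc.2 (hab i).1.le))]
  simp only [heq]
  exact h k a b hab hdisj hsum

theorem ae_hasDerivAt_valueDeriv (M : Model A Q R C β) (hζ : 0 < zeta A Q R C) :
    ∀ᵐ x ∂(volume.restrict (Ioi (0 : ℝ))),
      ∃ d : ℝ, d < 0 ∧ HasDerivAt (valueDeriv A Q R C β) d x := by
  have hmono : MonotoneOn (fun x => -xi A Q R C β x) (Ioi 0) := fun x hx y hy hxy =>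
    neg_le_neg ((M.xi_strictAntiOn hζ).antitoneOn (Ioi_subset_Ici_self hx)
      (Ioi_subset_Ici_self hy) hxy)
  filter_upwards [hmono.ae_differentiableWithinAt measurableSet_Ioi,
    ae_restrict_mem measurableSet_Ioi] with x hd hx
  have hx0 : (0 : ℝ) < x := hx
  have h1 : HasDerivAt (xi A Q R C β) (deriv (xi A Q R C β) x) x := by
    have := (hd.differentiableAt (Ioi_mem_nhds hx0)).fun_neg
    simp only [neg_neg] at this
    exact this.hasDerivAt
  refine ⟨deriv (xi A Q R C β) x, ?_, h1.congr_of_eventuallyEq ?_⟩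
  · obtain ⟨l, hl, hle⟩ := M.le_xi_sub hζ (b := x + 1) (by linarith)
    have hslope := (hasDerivWithinAt_iff_tendsto_slope' (notMem_Ioi.2 le_rfl)).1
      (h1.hasDerivWithinAt (s := Ioi x))
    have : deriv (xi A Q R C β) x ≤ -l := by
      refine le_of_tendsto hslope ?_
      filter_upwards [Ioo_mem_nhdsGT (show x < x + 1 by linarith)] with y hy
      have := hle x y hx0.le hy.1.le hy.2.le
      rw [slope_def_field, div_le_iff₀ (sub_pos.2 hy.1)]
      linarith
    linarith
  · filter_upwards [Ioi_mem_nhds hx0] with y hy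
    exact M.valueDeriv_eq hζ (le_of_lt hy)

end Model
end Firm

theorem theorem1 (A Q : Set ℝ) (R C : ℝ → ℝ) (β : ℝ)
    (hβ : 0 < β)
    (hA_closed : IsClosed A) (hA_nonneg : A ⊆ Ici 0)
    (hQ_compact : IsCompact Q) (hQ_nonneg : Q ⊆ Ici 0)
    (h0A : (0 : ℝ) ∈ A) (h0Q : (0 : ℝ) ∈ Q)
    (hA : (A \ {0}).Nonempty) (hQ : (Q \ {0}).Nonempty)
    (hR_cont : ContinuousOn R Q) (hR_nonneg : ∀ q ∈ Q, 0 ≤ R q) (hR0 : R 0 = 0)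
    (hC_cont : ContinuousOn C A) (hC_nonneg : ∀ a ∈ A, 0 ≤ C a) (hC_mono : MonotoneOn C A)
    (hC_coercive : ¬ Bornology.IsBounded A →
      Tendsto (fun a => C a / a) (atTop ⊓ 𝓟 A) atTop) :
    -- the Hamiltonian is finite, and `ζ ≥ 0` is its least minimum point
    (∀ z : ℝ, BddAbove ((fun q => R q - q * z) '' Q) ∧
      BddAbove ((fun a => a * z - C a) '' A)) ∧
    IsLeast (Firm.minPoints A Q R C) (Firm.zeta A Q R C) ∧
    0 ≤ Firm.zeta A Q R C ∧
    -- the value function is finite and bounded; its upper bound is its limit at infinity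
    (∀ x : ℝ, 0 ≤ x → Firm.extValue A Q R C β x = ((Firm.value A Q R C β x : ℝ) : EReal)) ∧
    (∃ M : ℝ, ∀ x : ℝ, 0 ≤ x → |Firm.value A Q R C β x| ≤ M) ∧
    (∀ x : ℝ, 0 ≤ x → Firm.value A Q R C β x ≤ Firm.hamiltonian A Q R C 0 / β) ∧
    Tendsto (Firm.value A Q R C β) atTop (𝓝 (Firm.hamiltonian A Q R C 0 / β)) ∧
    -- case (i)
    (Firm.zeta A Q R C = 0 →
      ∀ x : ℝ, 0 ≤ x → Firm.value A Q R C β x = Firm.hamiltonian A Q R C 0 / β) ∧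
    -- case (ii)
    (0 < Firm.zeta A Q R C →
      -- `Ψ` is well defined and has an inverse `ξ : [0, ∞) → (0, ζ]`
      (∀ᵐ z ∂(volume.restrict (Ioo 0 (Firm.zeta A Q R C))),
        DifferentiableAt ℝ (Firm.hamiltonian A Q R C) z) ∧
      (∀ ξ ∈ Ioc 0 (Firm.zeta A Q R C),
        IntervalIntegrable (Firm.psiIntegrand A Q R C β) volume ξ (Firm.zeta A Q R C)) ∧
      BijOn (Firm.Psi A Q R C β) (Ioc 0 (Firm.zeta A Q R C)) (Ici 0) ∧
      -- the representation of the value function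
      (∀ x : ℝ, 0 ≤ x →
        IntervalIntegrable (Firm.xi A Q R C β) volume 0 x ∧
        Firm.value A Q R C β x =
          Firm.hamiltonian A Q R C (Firm.xi A Q R C β x) / β ∧
        Firm.value A Q R C β x =
          Firm.hamiltonian A Q R C (Firm.zeta A Q R C) / β +
            ∫ y in (0 : ℝ)..x, Firm.xi A Q R C β y) ∧
      -- regularity
      ContDiffOn ℝ 1 (Firm.value A Q R C β) (Ici 0) ∧
      StrictMonoOn (Firm.value A Q R C β) (Ici 0) ∧
      StrictConcaveOn ℝ (Ici 0) (Firm.value A Q R C β) ∧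
      Firm.AbsContOn (Firm.valueDeriv A Q R C β) (Ici 0) ∧
      Firm.valueDeriv A Q R C β 0 = Firm.zeta A Q R C ∧
      Tendsto (Firm.valueDeriv A Q R C β) atTop (𝓝 0) ∧
      ∀ᵐ x ∂(volume.restrict (Ioi (0 : ℝ))),
        ∃ d : ℝ, d < 0 ∧ HasDerivAt (Firm.valueDeriv A Q R C β) d x) := by
  have M : Firm.Model A Q R C β := ⟨hβ, hA_closed, hA_nonneg, hQ_compact, hQ_nonneg, h0A, h0Q, hA,
    hQ, hR_cont, hR_nonneg, hR0, hC_cont, hC_nonneg, hC_mono, hC_coercive⟩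
  refine ⟨fun z => ⟨(M.isGreatest_sales z).isLUB.bddAbove, (M.isGreatest_prod z).isLUB.bddAbove⟩,
    M.isLeast_zeta, M.zeta_nonneg, fun x hx => M.extValue_eq_coe_value hx, ?_,
    fun x hx => M.value_le hx, M.tendsto_value,
    fun hζ x hx => M.value_eq_of_zeta_eq_zero hζ hx, fun hζ => ?_⟩
  · refine ⟨max |Firm.hamiltonian A Q R C (Firm.zeta A Q R C) / β|
      |Firm.hamiltonian A Q R C 0 / β|, fun x hx => ?_⟩
    exact abs_le_max_abs_abs (M.le_value hx) (M.value_le hx)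
  refine ⟨ae_restrict_of_ae ?_, fun p hp => M.intervalIntegrable_psiIntegrand hp.1 hζ,
    M.Psi_bijOn hζ, fun x hx => ⟨M.intervalIntegrable_xi hζ hx, M.value_eq hζ hx,
      M.value_eq_integral hζ hx⟩, M.contDiffOn_value hζ, M.strictMonoOn_value hζ,
    M.strictConcaveOn_value hζ, M.absContOn_valueDeriv hζ, ?_, ?_, M.ae_hasDerivAt_valueDeriv hζ⟩
  · filter_upwards [compl_mem_ae_iff.2 (M.countable_drift.measure_zero volume)] with z hz
    exact (M.hasDerivAt_hamiltonian (not_not.1 hz)).differentiableAt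
  · rw [M.valueDeriv_eq hζ le_rfl, M.xi_zero hζ]
  · refine (M.tendsto_xi hζ).congr' ?_
    filter_upwards [eventually_ge_atTop 0] with x hx
    rw [M.valueDeriv_eq hζ hx]
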